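/- Write points of $\mathbb{R}^{2d}$ as $(x,y)$ with $x,y\in\mathbb{R}^d$, let $\langle\cdot,\cdot\rangle$ be the $\mathcal{S}'\times\mathcal{S}$ bracket extending $\langle f,g\rangle=\int f\,\overline{g}$ (conjugate-linear in the second entry), let $(f\otimes g)(x,y)=f(x)g(y)$, $T_c u=u(\cdot-c)$, and let $\mathcal{F}_2^{-1}$ be the inverse Fourier transform in the second variable, $\mathcal{F}_2^{-1}f(x,y)=\int_{\mathbb{R}^d} f(x,\eta)e^{2\pi i\eta\cdot y}\,d\eta$, extended to $\mathcal{S}'(\mathbb{R}^{2d})$. For $z=(x,\xi)$ with $x,\xi\in\mathbb{R}^{2d}$ and $\tau\in\mathbb{R}$ let $\rho(z;\tau)f(t)=e^{2\pi i\tau}e^{-\pi i\xi\cdot x}e^{2\pi i\xi\cdot t}f(t-x)$ on $L^2(\mathbb{R}^{2d})$. Let $\mathcal{A}\in Sp(2d,\mathbb{R})$ be totally Wigner-decomposable, that is, $\mathcal{A}=\mathcal{A}_{FT2}\mathcal{D}_E$ with $E\in GL(2d,\mathbb{R})$, $$\mathcal{A}_{FT2}=\begin{pmatrix}I&0&0&0\\0&0&0&I\\0&0&I&0\\0&-I&0&0\end{pmatrix},\qquad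 \mathcal{D}_E=\begin{pmatrix}E^{-1}&0\\0&E^T\end{pmatrix},$$ where the blocks in $\mathcal{A}_{FT2}$ are $d\times d$, and let $$E=\begin{pmatrix}A&B\\C&D\end{pmatrix},\qquad E^{-1}=\begin{pmatrix}A'&B'\\C'&D'\end{pmatrix}$$ with $d\times d$ blocks. Let $\hat{\mathcal{A}}$ be a metaplectic operator over $\mathcal{A}$, that is, a unitary operator on $L^2(\mathbb{R}^{2d})$ with $\hat{\mathcal{A}}\rho(z;\tau)\hat{\mathcal{A}}^{-1}=\rho(\mathcal{A}z;\tau)$ for all $z\in\mathbb{R}^{4d}$, $\tau\in\mathbb{R}$. Let $a\in\mathcal{S}'(\mathbb{R}^{2d})$ and $\varphi_1,\varphi_2\in\mathcal{S}(\mathbb{R}^d)$. Then $W_{\mathcal{A}}(f,g)=\hat{\mathcal{A}}(f\otimes\overline{g})$ lies in $\mathcal{S}(\mathbb{R}^{2d})$ for all $f,g\in\mathcal{S}(\mathbb{R}^d)$, and the $\mathcal{A}$-localization operator $A^{\varphi_1,\varphi_2}_{a,\mathcal{A}}:\mathcal{S}(\mathbb{R}^d)\to\mathcal{S}'(\mathbb{R}^d)$,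 $$\langle A^{\varphi_1,\varphi_2}_{a,\mathcal{A}}f,g\rangle=\langle a*W_{\mathcal{A}}(\varphi_2,\varphi_1),W_{\mathcal{A}}(g,f)\rangle\qquad(f,g\in\mathcal{S}(\mathbb{R}^d)),$$ is well defined, linear and continuous (for the topology of pointwise convergence on $\mathcal{S}'(\mathbb{R}^d)$). It has exactly one Schwartz kernel, i.e. one $k\in\mathcal{S}'(\mathbb{R}^{2d})$ with $\langle A^{\varphi_1,\varphi_2}_{a,\mathcal{A}}f,g\rangle=\langle k,g\otimes\overline{f}\rangle$ for all $f,g\in\mathcal{S}(\mathbb{R}^d)$, and $$k(x,y)=\int_{\mathbb{R}^d}\bigl(T_{(t,0)}\mathcal{F}_2^{-1}a\bigr)(E^{-1}(x,y))\;\varphi_2\bigl(At+B(C'x+D'y)\bigr)\;\overline{\varphi_1\bigl(Ct+D(C'x+D'y)\bigr)}\,dt$$ in the weak sense: if $k_t\in\mathcal{S}'(\mathbb{R}^{2d})$ denotes the integrand for fixed $t$, then for every $h\in\mathcal{S}(\mathbb{R}^{2d})$ the function $t\mapsto\langle k_t,h\rangle$ is integrable on $\mathbb{R}^d$ and $\langle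 k,h\rangle=\int_{\mathbb{R}^d}\langle k_t,h\rangle\,dt$. -/

import Mathlib

open MeasureTheory SchwartzMap FourierTransform
open scoped Matrix RealInnerProductSpace ContDiff

namespace MetaLoc
noncomputable section

section coords
variable {α β : Type} [Fintype α] [Fintype β]

/-- The first block `x` of a vector `(x, y)`. -/
def fstE : EuclideanSpace ℝ (α ⊕ β) →L[ℝ] EuclideanSpace ℝ α :=
  LinearMap.toContinuousLinearMap
    { toFun := fun z => WithLp.toLp 2 fun i => z (Sum.inl i)
      map_add' := fun _ _ => by ext; simp
      map_smul' := fun _ _ => by ext; simp }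

/-- The second block `y` of a vector `(x, y)`. -/
def sndE : EuclideanSpace ℝ (α ⊕ β) →L[ℝ] EuclideanSpace ℝ β :=
  LinearMap.toContinuousLinearMap
    { toFun := fun z => WithLp.toLp 2 fun i => z (Sum.inr i)
      map_add' := fun _ _ => by ext; simp
      map_smul' := fun _ _ => by ext; simp }

/-- The vector `(x, y)` with blocks `x` and `y`. -/
def pairE (x : EuclideanSpace ℝ α) (y : EuclideanSpace ℝ β) : EuclideanSpace ℝ (α ⊕ β) :=
  WithLp.toLp 2 (Sum.elim x y)

@[simp] theorem fstE_apply (z : EuclideanSpace ℝ (α ⊕ β)) (i : α) :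
    fstE z i = z (Sum.inl i) := rfl
@[simp] theorem sndE_apply (z : EuclideanSpace ℝ (α ⊕ β)) (i : β) :
    sndE z i = z (Sum.inr i) := rfl
@[simp] theorem fstE_pairE (x : EuclideanSpace ℝ α) (y : EuclideanSpace ℝ β) :
    fstE (pairE x y) = x := rfl
@[simp] theorem sndE_pairE (x : EuclideanSpace ℝ α) (y : EuclideanSpace ℝ β) :
    sndE (pairE x y) = y := rfl
@[simp] theorem pairE_fstE_sndE (z : EuclideanSpace ℝ (α ⊕ β)) :
    pairE (fstE z) (sndE z) = z := by
  ext i; cases i <;> rfl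

theorem norm_sq_eq (z : EuclideanSpace ℝ (α ⊕ β)) :
    ‖z‖ ^ 2 = ‖fstE z‖ ^ 2 + ‖sndE z‖ ^ 2 := by
  simp [EuclideanSpace.norm_sq_eq]

theorem norm_fstE_le (z : EuclideanSpace ℝ (α ⊕ β)) : ‖fstE z‖ ≤ ‖z‖ := by
  have := norm_sq_eq z
  exact le_of_sq_le_sq (by nlinarith [sq_nonneg ‖sndE z‖]) (norm_nonneg _)

theorem norm_sndE_le (z : EuclideanSpace ℝ (α ⊕ β)) : ‖sndE z‖ ≤ ‖z‖ := by
  have := norm_sq_eq z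
  exact le_of_sq_le_sq (by nlinarith [sq_nonneg ‖fstE z‖]) (norm_nonneg _)

theorem norm_le_add (z : EuclideanSpace ℝ (α ⊕ β)) : ‖z‖ ≤ ‖fstE z‖ + ‖sndE z‖ := by
  have := norm_sq_eq z
  refine le_of_sq_le_sq ?_ (by positivity)
  nlinarith [mul_nonneg (norm_nonneg (fstE z)) (norm_nonneg (sndE z))]

theorem norm_pow_le (z : EuclideanSpace ℝ (α ⊕ β)) (k : ℕ) :
    ‖z‖ ^ k ≤ 2 ^ k * (‖fstE z‖ ^ k + ‖sndE z‖ ^ k) := by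
  have h := norm_le_add z
  rcases le_total ‖fstE z‖ ‖sndE z‖ with h' | h'
  · calc ‖z‖ ^ k ≤ (2 * ‖sndE z‖) ^ k := by gcongr; linarith
      _ = 2 ^ k * ‖sndE z‖ ^ k := mul_pow _ _ _
      _ ≤ _ := by gcongr; simp
  · calc ‖z‖ ^ k ≤ (2 * ‖fstE z‖) ^ k := by gcongr; linarith
      _ = 2 ^ k * ‖fstE z‖ ^ k := mul_pow _ _ _
      _ ≤ _ := by gcongr; simp

/-- The inclusion `y ↦ (0, y)`. -/
def inrE : EuclideanSpace ℝ β →L[ℝ] EuclideanSpace ℝ (α ⊕ β) :=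
  LinearMap.toContinuousLinearMap
    { toFun := fun y => pairE 0 y
      map_add' := fun _ _ => by ext i; cases i <;> simp [pairE]
      map_smul' := fun _ _ => by ext i; cases i <;> simp [pairE] }

/-- The inclusion `x ↦ (x, 0)`. -/
def inlE : EuclideanSpace ℝ α →L[ℝ] EuclideanSpace ℝ (α ⊕ β) :=
  LinearMap.toContinuousLinearMap
    { toFun := fun x => pairE x 0
      map_add' := fun _ _ => by ext i; cases i <;> simp [pairE]
      map_smul' := fun _ _ => by ext i; cases i <;> simp [pairE] }

theorem pairE_eq (x : EuclideanSpace ℝ α) (y : EuclideanSpace ℝ β) :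
    pairE x y = inlE x + inrE y := by
  ext i; cases i <;> simp [pairE, inlE, inrE]

theorem norm_inrE_le : ‖(inrE : EuclideanSpace ℝ β →L[ℝ] EuclideanSpace ℝ (α ⊕ β))‖ ≤ 1 :=
  ContinuousLinearMap.opNorm_le_bound _ zero_le_one fun y => by
    have h := norm_le_add (pairE (0 : EuclideanSpace ℝ α) y)
    rw [fstE_pairE, sndE_pairE, norm_zero, zero_add] at h
    rw [one_mul]
    exact h

theorem opNorm_fstE_le :
    ‖(fstE : EuclideanSpace ℝ (α ⊕ β) →L[ℝ] EuclideanSpace ℝ α)‖ ≤ 1 :=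
  ContinuousLinearMap.opNorm_le_bound _ zero_le_one fun z => by simpa using norm_fstE_le z

theorem opNorm_sndE_le :
    ‖(sndE : EuclideanSpace ℝ (α ⊕ β) →L[ℝ] EuclideanSpace ℝ β)‖ ≤ 1 :=
  ContinuousLinearMap.opNorm_le_bound _ zero_le_one fun z => by simpa using norm_sndE_le z

end coords

section tensor
variable {α β : Type} [Fintype α] [Fintype β]

theorem norm_iteratedFDeriv_comp_clm_le {V W : Type} [NormedAddCommGroup V] [NormedSpace ℝ V]
    [NormedAddCommGroup W] [NormedSpace ℝ W] (L : V →L[ℝ] W) (hL : ‖L‖ ≤ 1)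
    (f : 𝓢(W, ℂ)) (n : ℕ) (x : V) :
    ‖iteratedFDeriv ℝ n (fun v => f (L v)) x‖ ≤ ‖iteratedFDeriv ℝ n f (L x)‖ := by
  have := L.iteratedFDeriv_comp_right (f.smooth n) x le_rfl
  change ‖iteratedFDeriv ℝ n (f ∘ L) x‖ ≤ _
  rw [this]
  refine (ContinuousMultilinearMap.norm_compContinuousLinearMap_le _ _).trans ?_
  refine mul_le_of_le_one_right (norm_nonneg _) ?_
  exact Finset.prod_le_one (fun _ _ => norm_nonneg _) fun _ _ => hL

theorem contDiff_comp_clm {V W F : Type} [NormedAddCommGroup V] [NormedSpace ℝ V]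
    [NormedAddCommGroup W] [NormedSpace ℝ W] [NormedAddCommGroup F] [NormedSpace ℝ F]
    (L : V →L[ℝ] W) (f : 𝓢(W, F)) : ContDiff ℝ ∞ (fun v => f (L v)) :=
  ContDiff.comp (g := f) (f := L) (f.smooth ⊤) L.contDiff

theorem contDiff_fst (f : 𝓢(EuclideanSpace ℝ α, ℂ)) :
    ContDiff ℝ ∞ (fun z : EuclideanSpace ℝ (α ⊕ β) => f (fstE z)) :=
  contDiff_comp_clm (fstE (α := α) (β := β)) f

theorem contDiff_snd (g : 𝓢(EuclideanSpace ℝ β, ℂ)) :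
    ContDiff ℝ ∞ (fun z : EuclideanSpace ℝ (α ⊕ β) => g (sndE z)) :=
  contDiff_comp_clm (sndE (α := α) (β := β)) g

theorem tensor_bound (f : 𝓢(EuclideanSpace ℝ α, ℂ)) (k n : ℕ) :
    ∃ (s : Finset (ℕ × ℕ)) (C : ℝ), 0 ≤ C ∧ ∀ (g : 𝓢(EuclideanSpace ℝ β, ℂ))
      (z : EuclideanSpace ℝ (α ⊕ β)),
      ‖z‖ ^ k * ‖iteratedFDeriv ℝ n (fun z => f (fstE z) * g (sndE z)) z‖ ≤
        C * s.sup (schwartzSeminormFamily ℂ _ ℂ) g := by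
  refine ⟨Finset.Iic (k, n), ∑ i ∈ Finset.range (n + 1), n.choose i * (2 ^ k *
    (SchwartzMap.seminorm ℂ k i f + SchwartzMap.seminorm ℂ 0 i f)), by positivity, fun g z => ?_⟩
  have h1 := norm_iteratedFDeriv_mul_le (𝕜 := ℝ) (A := ℂ) (N := ∞)
    (f := fun z : EuclideanSpace ℝ (α ⊕ β) => f (fstE z))
    (g := fun z : EuclideanSpace ℝ (α ⊕ β) => g (sndE z))
    (contDiff_fst f) (contDiff_snd g) z (n := n)
    (mod_cast le_top)
  refine (mul_le_mul_of_nonneg_left h1 (by positivity)).trans ?_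
  rw [Finset.mul_sum, Finset.sum_mul]
  refine Finset.sum_le_sum fun i hi => ?_
  have hi' : i ≤ n := by simpa [Nat.lt_succ_iff] using hi
  set S := (Finset.Iic (k, n)).sup (schwartzSeminormFamily ℂ (EuclideanSpace ℝ β) ℂ) g with hS
  have hg : ∀ k' n', k' ≤ k → n' ≤ n → SchwartzMap.seminorm ℂ k' n' g ≤ S := by
    intro k' n' hk hn
    exact Seminorm.le_def.mp (Finset.le_sup (f := schwartzSeminormFamily ℂ
      (EuclideanSpace ℝ β) ℂ) (Finset.mem_Iic.mpr (show (k', n') ≤ (k, n) from ⟨hk, hn⟩))) g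
  have hf := norm_iteratedFDeriv_comp_clm_le (fstE (α := α) (β := β)) opNorm_fstE_le f i z
  have hgg := norm_iteratedFDeriv_comp_clm_le (sndE (α := α) (β := β)) opNorm_sndE_le g (n - i) z
  set a := ‖iteratedFDeriv ℝ i f (fstE z)‖
  set b := ‖iteratedFDeriv ℝ (n - i) g (sndE z)‖
  have hb0 : b ≤ S := ((SchwartzMap.norm_iteratedFDeriv_le_seminorm ℂ g (n - i) (sndE z))).trans
    (hg 0 _ (Nat.zero_le _) (Nat.sub_le _ _))
  have hbk : ‖sndE z‖ ^ k * b ≤ S := (SchwartzMap.le_seminorm ℂ k (n - i) g (sndE z)).trans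
    (hg k _ le_rfl (Nat.sub_le _ _))
  have ha0 : a ≤ SchwartzMap.seminorm ℂ 0 i f :=
    SchwartzMap.norm_iteratedFDeriv_le_seminorm ℂ f i (fstE z)
  have hak : ‖fstE z‖ ^ k * a ≤ SchwartzMap.seminorm ℂ k i f :=
    SchwartzMap.le_seminorm ℂ k i f (fstE z)
  have hS0 : 0 ≤ S := (norm_nonneg _).trans hb0
  calc _ ≤ (2 ^ k * (‖fstE z‖ ^ k + ‖sndE z‖ ^ k)) * (n.choose i * a * b) := by
        gcongr; exact norm_pow_le z k
    _ = n.choose i * (2 ^ k * ((‖fstE z‖ ^ k * a) * b + a * (‖sndE z‖ ^ k * b))) := by ring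
    _ ≤ n.choose i * (2 ^ k * (SchwartzMap.seminorm ℂ k i f * S +
          SchwartzMap.seminorm ℂ 0 i f * S)) := by gcongr
    _ = _ := by ring

/-- The tensor product `(f ⊗ g)(x, y) = f(x) g(y)` of Schwartz functions, continuous in `g`. -/
def tensorCLM (f : 𝓢(EuclideanSpace ℝ α, ℂ)) :
    𝓢(EuclideanSpace ℝ β, ℂ) →L[ℂ] 𝓢(EuclideanSpace ℝ (α ⊕ β), ℂ) :=
  SchwartzMap.mkCLM (σ := RingHom.id ℂ) (fun g z => f (fstE z) * g (sndE z))
    (fun _ _ _ => by simp [mul_add]) (fun _ _ _ => by simp; ring)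
    (fun g => (contDiff_fst f).mul (contDiff_snd g))
    (fun n => tensor_bound f n.1 n.2)

/-- The tensor product `(f ⊗ g)(x, y) = f(x) g(y)` of Schwartz functions. -/
def tensor (f : 𝓢(EuclideanSpace ℝ α, ℂ)) (g : 𝓢(EuclideanSpace ℝ β, ℂ)) :
    𝓢(EuclideanSpace ℝ (α ⊕ β), ℂ) := tensorCLM f g

@[simp] theorem tensor_apply (f : 𝓢(EuclideanSpace ℝ α, ℂ)) (g : 𝓢(EuclideanSpace ℝ β, ℂ))
    (z : EuclideanSpace ℝ (α ⊕ β)) : tensor f g z = f (fstE z) * g (sndE z) := rfl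

end tensor

section partialFourier
variable {α β : Type} [Fintype α] [Fintype β]
variable {F : Type} [NormedAddCommGroup F] [NormedSpace ℂ F]

theorem pairE_hasTemperateGrowth (x : EuclideanSpace ℝ α) :
    Function.HasTemperateGrowth (fun y : EuclideanSpace ℝ β => pairE x y) := by
  have : (fun y : EuclideanSpace ℝ β => pairE x y) = fun y => inlE x + inrE y := by
    ext1 y; exact pairE_eq x y
  rw [this]
  fun_prop

/-- The slice `y ↦ f(x, y)` of a Schwartz function. -/
def slice (x : EuclideanSpace ℝ α) :
    𝓢(EuclideanSpace ℝ (α ⊕ β), F) →L[ℂ] 𝓢(EuclideanSpace ℝ β, F) :=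
  SchwartzMap.compCLM ℂ (pairE_hasTemperateGrowth x)
    ⟨1, 1, fun y => by
      have := norm_sndE_le (pairE x y)
      rw [sndE_pairE] at this
      linarith⟩

theorem slice_apply (x : EuclideanSpace ℝ α) (f : 𝓢(EuclideanSpace ℝ (α ⊕ β), F))
    (y : EuclideanSpace ℝ β) : slice x f y = f (pairE x y) := rfl

theorem slice_bound (x : EuclideanSpace ℝ α) (f : 𝓢(EuclideanSpace ℝ (α ⊕ β), F)) (j k n : ℕ) :
    ‖x‖ ^ j * SchwartzMap.seminorm ℂ k n (slice x f) ≤ SchwartzMap.seminorm ℂ (j + k) n f := by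
  rcases (pow_nonneg (norm_nonneg x) j).eq_or_lt with h0 | h0
  · rw [← h0, zero_mul]; exact apply_nonneg _ _
  rw [← le_div_iff₀' h0]
  refine SchwartzMap.seminorm_le_bound ℂ k n _ (by positivity) fun y => ?_
  rw [le_div_iff₀' h0]
  have h1 : ‖iteratedFDeriv ℝ n (slice x f) y‖ ≤ ‖iteratedFDeriv ℝ n f (pairE x y)‖ := by
    have e : (slice x f : EuclideanSpace ℝ β → F) =
        (fun z => f (inlE x + z)) ∘ (inrE : EuclideanSpace ℝ β →L[ℝ] EuclideanSpace ℝ (α ⊕ β)) := by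
      ext y; simp [slice_apply, pairE_eq]
    have hsm : ContDiff ℝ ∞ (fun z => f (inlE x + z)) :=
      ContDiff.comp (g := f) (f.smooth ⊤) (contDiff_const.add contDiff_id)
    rw [e, inrE.iteratedFDeriv_comp_right hsm y (mod_cast le_top),
      iteratedFDeriv_comp_add_left, ← pairE_eq]
    refine (ContinuousMultilinearMap.norm_compContinuousLinearMap_le _ _).trans ?_
    refine mul_le_of_le_one_right (norm_nonneg _) ?_
    exact Finset.prod_le_one (fun _ _ => norm_nonneg _) fun _ _ => norm_inrE_le
  have hx : ‖x‖ ≤ ‖pairE x y‖ := by simpa using norm_fstE_le (pairE x y)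
  have hy : ‖y‖ ≤ ‖pairE x y‖ := by simpa using norm_sndE_le (pairE x y)
  calc ‖x‖ ^ j * (‖y‖ ^ k * ‖iteratedFDeriv ℝ n (slice x f) y‖)
      ≤ ‖pairE x y‖ ^ j * (‖pairE x y‖ ^ k * ‖iteratedFDeriv ℝ n f (pairE x y)‖) := by gcongr
    _ = ‖pairE x y‖ ^ (j + k) * ‖iteratedFDeriv ℝ n f (pairE x y)‖ := by rw [pow_add]; ring
    _ ≤ _ := SchwartzMap.le_seminorm ℂ _ _ f _

/-- The inverse Fourier transform in the second variable,
`(x, y) ↦ ∫ exp(2πi η·y) f(x, η) dη`, as a function. -/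
def pfiFun (f : 𝓢(EuclideanSpace ℝ (α ⊕ β), F)) (z : EuclideanSpace ℝ (α ⊕ β)) : F :=
  ∫ η : EuclideanSpace ℝ β, Real.fourierChar (inner ℝ η (sndE z)) • f (pairE (fstE z) η)

theorem pfiFun_eq (f : 𝓢(EuclideanSpace ℝ (α ⊕ β), F)) (z : EuclideanSpace ℝ (α ⊕ β)) :
    pfiFun f z = (𝓕⁻ (slice (fstE z) f) : 𝓢(EuclideanSpace ℝ β, F)) (sndE z) := by
  rw [SchwartzMap.fourierInv_coe, Real.fourierInv_eq]
  rfl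

theorem fourierInv_bound (m : ℕ) : ∃ (s : Finset (ℕ × ℕ)) (C : ℝ), 0 ≤ C ∧
    ∀ (g : 𝓢(EuclideanSpace ℝ β, F)) (y : EuclideanSpace ℝ β),
      ‖y‖ ^ m * ‖(𝓕⁻ g : 𝓢(EuclideanSpace ℝ β, F)) y‖ ≤
        C * s.sup (schwartzSeminormFamily ℂ (EuclideanSpace ℝ β) F) g := by
  let q : Seminorm ℂ 𝓢(EuclideanSpace ℝ β, F) := (SchwartzMap.seminorm ℂ m 0).comp
        (fourierInvCLM ℂ 𝓢(EuclideanSpace ℝ β, F)).toLinearMap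
  have hq : Continuous q := Continuous.comp (g := SchwartzMap.seminorm ℂ m 0)
        ((schwartz_withSeminorms ℂ (EuclideanSpace ℝ β) F).continuous_seminorm (m, 0))
        (fourierInvCLM ℂ 𝓢(EuclideanSpace ℝ β, F)).continuous
  obtain ⟨s, C, -, hC⟩ := Seminorm.bound_of_continuous
      (schwartz_withSeminorms ℂ (EuclideanSpace ℝ β) F) q hq
  refine ⟨s, C, C.2, fun g y => ?_⟩
  exact (SchwartzMap.norm_pow_mul_le_seminorm ℂ _ m _).trans (hC g)

theorem seminorm_le_sup {E : Type} [NormedAddCommGroup E] [NormedSpace ℝ E]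
    {s : Finset (ℕ × ℕ)} {p : ℕ × ℕ} (hp : p ∈ s) (f : 𝓢(E, F)) :
    SchwartzMap.seminorm ℂ p.1 p.2 f ≤ s.sup (schwartzSeminormFamily ℂ E F) f :=
  Seminorm.le_def.mp (Finset.le_sup (f := schwartzSeminormFamily ℂ E F) hp) f

theorem sup_mono' {E : Type} [NormedAddCommGroup E] [NormedSpace ℝ E]
    {s t : Finset (ℕ × ℕ)} (h : s ⊆ t) (f : 𝓢(E, F)) :
    s.sup (schwartzSeminormFamily ℂ E F) f ≤ t.sup (schwartzSeminormFamily ℂ E F) f :=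
  Seminorm.le_def.mp (Finset.sup_mono h) f

theorem slice_sup_bound (x : EuclideanSpace ℝ α) (f : 𝓢(EuclideanSpace ℝ (α ⊕ β), F)) (j : ℕ)
    (s : Finset (ℕ × ℕ)) :
    ‖x‖ ^ j * s.sup (schwartzSeminormFamily ℂ (EuclideanSpace ℝ β) F) (slice x f) ≤
      (s.image fun p => (j + p.1, p.2)).sup
        (schwartzSeminormFamily ℂ (EuclideanSpace ℝ (α ⊕ β)) F) f := by
  rcases (pow_nonneg (norm_nonneg x) j).eq_or_lt with h0 | h0
  · rw [← h0, zero_mul]; exact apply_nonneg _ _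
  rw [← le_div_iff₀' h0]
  refine Seminorm.finset_sup_apply_le (div_nonneg (apply_nonneg _ _) h0.le) fun p hp => ?_
  rw [le_div_iff₀' h0]
  have hm : (j + p.1, p.2) ∈ s.image fun p => (j + p.1, p.2) := Finset.mem_image_of_mem _ hp
  exact (slice_bound x f j p.1 p.2).trans (seminorm_le_sup hm f)

theorem pfiFun_bound_aux (j m : ℕ) : ∃ (s : Finset (ℕ × ℕ)) (C : ℝ), 0 ≤ C ∧
      ∀ (f : 𝓢(EuclideanSpace ℝ (α ⊕ β), F)) (z : EuclideanSpace ℝ (α ⊕ β)),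
      ‖fstE z‖ ^ j * ‖sndE z‖ ^ m * ‖pfiFun f z‖ ≤
        C * s.sup (schwartzSeminormFamily ℂ (EuclideanSpace ℝ (α ⊕ β)) F) f := by
  obtain ⟨s, C, hC0, hC⟩ := fourierInv_bound (β := β) (F := F) m
  refine ⟨s.image fun p => (j + p.1, p.2), C, hC0, fun f z => ?_⟩
  have h1 := hC (slice (fstE z) f) (sndE z)
  rw [← pfiFun_eq] at h1
  have h2 := slice_sup_bound (fstE z) f j s
  rw [mul_assoc]
  refine (mul_le_mul_of_nonneg_left h1 (by positivity)).trans ?_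
  rw [mul_left_comm]
  exact mul_le_mul_of_nonneg_left h2 hC0

theorem pfiFun_bound_zero (k : ℕ) :
    ∃ (s : Finset (ℕ × ℕ)) (C : ℝ), 0 ≤ C ∧ ∀ (f : 𝓢(EuclideanSpace ℝ (α ⊕ β), F))
      (z : EuclideanSpace ℝ (α ⊕ β)),
      ‖z‖ ^ k * ‖pfiFun f z‖ ≤
        C * s.sup (schwartzSeminormFamily ℂ (EuclideanSpace ℝ (α ⊕ β)) F) f := by
  obtain ⟨s₁, C₁, hC₁, h₁⟩ := pfiFun_bound_aux (α := α) (β := β) (F := F) k 0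
  obtain ⟨s₂, C₂, hC₂, h₂⟩ := pfiFun_bound_aux (α := α) (β := β) (F := F) 0 k
  refine ⟨s₁ ∪ s₂, 2 ^ k * (C₁ + C₂), by positivity, fun f z => ?_⟩
  have e₁ := h₁ f z
  have e₂ := h₂ f z
  simp only [pow_zero, mul_one, one_mul] at e₁ e₂
  have m₁ := sup_mono' (Finset.subset_union_left (s₁ := s₁) (s₂ := s₂)) f
  have m₂ := sup_mono' (Finset.subset_union_right (s₁ := s₁) (s₂ := s₂)) f
  replace e₁ := e₁.trans (mul_le_mul_of_nonneg_left m₁ hC₁)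
  replace e₂ := e₂.trans (mul_le_mul_of_nonneg_left m₂ hC₂)
  generalize (s₁ ∪ s₂).sup (schwartzSeminormFamily ℂ (EuclideanSpace ℝ (α ⊕ β)) F) f = B at e₁ e₂ ⊢
  calc ‖z‖ ^ k * ‖pfiFun f z‖ ≤ (2 ^ k * (‖fstE z‖ ^ k + ‖sndE z‖ ^ k)) * ‖pfiFun f z‖ := by
        gcongr; exact norm_pow_le z k
    _ = 2 ^ k * (‖fstE z‖ ^ k * ‖pfiFun f z‖ + ‖sndE z‖ ^ k * ‖pfiFun f z‖) := by ring
    _ ≤ 2 ^ k * (C₁ * B + C₂ * B) := by gcongr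
    _ = _ := by ring

/-- Precomposition of a derivative with `(x, y) ↦ (x, 0)`. -/
def precompFst : (EuclideanSpace ℝ (α ⊕ β) →L[ℝ] F) →L[ℂ] (EuclideanSpace ℝ (α ⊕ β) →L[ℝ] F) :=
  LinearMap.mkContinuous
    { toFun := fun L => L ∘L (inlE ∘L fstE)
      map_add' := fun _ _ => rfl
      map_smul' := fun _ _ => rfl }
    ‖(inlE ∘L fstE : EuclideanSpace ℝ (α ⊕ β) →L[ℝ] EuclideanSpace ℝ (α ⊕ β))‖
    (fun L => by
      rw [mul_comm]
      exact ContinuousLinearMap.opNorm_comp_le L _)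

/-- The Schwartz function whose partial inverse Fourier transform is the derivative of that
of `f`. -/
def pfiDeriv : 𝓢(EuclideanSpace ℝ (α ⊕ β), F) →L[ℂ]
    𝓢(EuclideanSpace ℝ (α ⊕ β), EuclideanSpace ℝ (α ⊕ β) →L[ℝ] F) :=
  SchwartzMap.postcompCLM precompFst ∘L SchwartzMap.fderivCLM ℂ _ F +
    (2 * Real.pi * Complex.I) • SchwartzMap.smulRightCLM ℂ F
      ((innerSL ℝ : EuclideanSpace ℝ β →L[ℝ] EuclideanSpace ℝ β →L[ℝ] ℝ).bilinearComp sndE sndE)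

theorem pfiDeriv_apply (f : 𝓢(EuclideanSpace ℝ (α ⊕ β), F)) (z v : EuclideanSpace ℝ (α ⊕ β)) :
    pfiDeriv f z v = fderiv ℝ f z (inlE (fstE v)) +
      (2 * Real.pi * Complex.I) • (inner ℝ (sndE z) (sndE v) • f z) := by
  simp [pfiDeriv, precompFst]
  rfl

theorem slice_dominated {G : Type} [NormedAddCommGroup G] [NormedSpace ℝ G]
    (h : 𝓢(EuclideanSpace ℝ (α ⊕ β), G)) :
    ∃ b : EuclideanSpace ℝ β → ℝ, Integrable b ∧ ∀ x η, ‖h (pairE x η)‖ ≤ b η := by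
  set N : ℕ := Module.finrank ℝ (EuclideanSpace ℝ β) + 1 with hN
  set C : ℝ := 2 ^ N * (Finset.Iic (N, 0)).sup
    (schwartzSeminormFamily ℝ (EuclideanSpace ℝ (α ⊕ β)) G) h with hC
  refine ⟨fun η => C * (1 + ‖η‖) ^ (-(N : ℝ)), ?_, fun x η => ?_⟩
  · exact (integrable_one_add_norm (by rw [hN]; push_cast; linarith)).const_mul C
  · have h1 := SchwartzMap.one_add_le_sup_seminorm_apply (𝕜 := ℝ) (m := (N, 0)) le_rfl le_rfl h
      (pairE x η)
    rw [norm_iteratedFDeriv_zero] at h1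
    have hy : ‖η‖ ≤ ‖pairE x η‖ := by simpa using norm_sndE_le (pairE x η)
    have hpos : (0 : ℝ) < (1 + ‖η‖) ^ N := by positivity
    change _ ≤ C * (1 + ‖η‖) ^ (-(N : ℝ))
    rw [Real.rpow_neg (by positivity), Real.rpow_natCast, ← div_eq_mul_inv, le_div_iff₀' hpos]
    refine le_trans ?_ h1
    gcongr

theorem slice_integrable (f : 𝓢(EuclideanSpace ℝ (α ⊕ β), F)) (z : EuclideanSpace ℝ (α ⊕ β)) :
    Integrable (fun η : EuclideanSpace ℝ β =>
      Real.fourierChar (inner ℝ η (sndE z)) • f (pairE (fstE z) η)) := by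
  obtain ⟨b, hb, hle⟩ := slice_dominated f
  refine hb.mono' (Continuous.aestronglyMeasurable ?_) (Filter.Eventually.of_forall fun η => ?_)
  · have : Continuous fun η : EuclideanSpace ℝ β => pairE (fstE z) η :=
      (pairE_hasTemperateGrowth _).1.continuous
    have h2 := f.continuous.comp this
    have h3 : Continuous fun η : EuclideanSpace ℝ β =>
      Real.fourierChar (inner ℝ η (sndE z)) := by fun_prop
    exact h3.smul h2
  · rw [Circle.norm_smul]; exact hle _ _

theorem hasFDerivAt_pfiFun (f : 𝓢(EuclideanSpace ℝ (α ⊕ β), F)) (z : EuclideanSpace ℝ (α ⊕ β)) :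
    HasFDerivAt (pfiFun f) (pfiFun (pfiDeriv f) z) z := by
  obtain ⟨b, hb, hle⟩ := slice_dominated (pfiDeriv f)
  refine hasFDerivAt_integral_of_dominated_of_fderiv_le (bound := b) (s := Set.univ)
    (F := fun w η => Real.fourierChar (inner ℝ η (sndE w)) • f (pairE (fstE w) η))
    (F' := fun w η => Real.fourierChar (inner ℝ η (sndE w)) • pfiDeriv f (pairE (fstE w) η))
    Filter.univ_mem
    (Filter.Eventually.of_forall fun w => (slice_integrable f w).aestronglyMeasurable)
    (slice_integrable f z) (slice_integrable (pfiDeriv f) z).aestronglyMeasurable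
    (Filter.Eventually.of_forall fun η w _ => (Circle.norm_smul _ _).le.trans (hle _ _)) hb
    (Filter.Eventually.of_forall fun η w _ => ?_)
  have h1 : HasFDerivAt (fun w : EuclideanSpace ℝ (α ⊕ β) => f (pairE (fstE w) η))
      ((fderiv ℝ f (pairE (fstE w) η)) ∘L (inlE ∘L fstE)) w := by
    have e : (fun w : EuclideanSpace ℝ (α ⊕ β) => pairE (fstE w) η) =
        fun w => (inlE ∘L fstE : EuclideanSpace ℝ (α ⊕ β) →L[ℝ] EuclideanSpace ℝ (α ⊕ β)) w +
          inrE η := by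
      ext1 w; exact pairE_eq _ _
    have h2 : HasFDerivAt (fun w : EuclideanSpace ℝ (α ⊕ β) => pairE (fstE w) η)
        (inlE ∘L fstE : EuclideanSpace ℝ (α ⊕ β) →L[ℝ] EuclideanSpace ℝ (α ⊕ β)) w := by
      rw [e]; exact (ContinuousLinearMap.hasFDerivAt _).add_const _
    exact HasFDerivAt.comp w (f.hasFDerivAt (pairE (fstE w) η)) h2
  have h3 : HasFDerivAt (fun w : EuclideanSpace ℝ (α ⊕ β) => (inner ℝ η (sndE w) : ℝ))
      ((innerSL ℝ η) ∘L sndE) w :=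
    ((innerSL ℝ η) ∘L sndE : EuclideanSpace ℝ (α ⊕ β) →L[ℝ] ℝ).hasFDerivAt
  have h4 : HasFDerivAt (fun w : EuclideanSpace ℝ (α ⊕ β) =>
      (Real.fourierChar (inner ℝ η (sndE w)) : ℂ)) _ w :=
    HasFDerivAt.comp (g := fun r : ℝ => (Real.fourierChar r : ℂ)) w
      (Real.hasDerivAt_fourierChar (inner ℝ η (sndE w))).hasFDerivAt h3
  have h5 := h4.smul h1
  refine h5.congr_fderiv ?_
  ext v
  simp only [add_apply, smul_apply, ContinuousLinearMap.smulRight_apply, Circle.smul_def,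
    pfiDeriv_apply, smul_add, sndE_pairE, ContinuousLinearMap.comp_apply, innerSL_apply_apply]
  congr 1
  rw [← Complex.coe_smul (inner ℝ η (sndE v)) (f _)]
  simp only [ContinuousLinearMap.toSpanSingleton_apply, Complex.real_smul, smul_smul]
  congr 1
  ring

theorem contDiff_pfiFun (n : ℕ) : ∀ {F : Type} [NormedAddCommGroup F] [NormedSpace ℂ F]
    (f : 𝓢(EuclideanSpace ℝ (α ⊕ β), F)), ContDiff ℝ n (pfiFun f) := by
  induction n with
  | zero =>
    intro F _ _ f
    exact contDiff_zero.mpr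
      (continuous_iff_continuousAt.mpr fun z => (hasFDerivAt_pfiFun f z).continuousAt)
  | succ n ih =>
    intro F _ _ f
    have e : fderiv ℝ (pfiFun f) = pfiFun (pfiDeriv f) := by
      ext1 z; exact (hasFDerivAt_pfiFun f z).fderiv
    push_cast
    rw [contDiff_succ_iff_fderiv]
    refine ⟨fun z => (hasFDerivAt_pfiFun f z).differentiableAt, by simp, ?_⟩
    rw [e]
    exact ih _

theorem pfiDeriv_sup_bound (s : Finset (ℕ × ℕ)) :
    ∃ (t : Finset (ℕ × ℕ)) (C : ℝ), 0 ≤ C ∧ ∀ f : 𝓢(EuclideanSpace ℝ (α ⊕ β), F),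
      s.sup (schwartzSeminormFamily ℂ (EuclideanSpace ℝ (α ⊕ β))
        (EuclideanSpace ℝ (α ⊕ β) →L[ℝ] F)) (pfiDeriv f) ≤
      C * t.sup (schwartzSeminormFamily ℂ (EuclideanSpace ℝ (α ⊕ β)) F) f := by
  let q : Seminorm ℂ 𝓢(EuclideanSpace ℝ (α ⊕ β), F) :=
    (s.sup (schwartzSeminormFamily ℂ (EuclideanSpace ℝ (α ⊕ β))
        (EuclideanSpace ℝ (α ⊕ β) →L[ℝ] F))).comp (pfiDeriv (α := α) (β := β) (F := F)).toLinearMap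
  have hc : Continuous ⇑(s.sup (schwartzSeminormFamily ℂ (EuclideanSpace ℝ (α ⊕ β))
        (EuclideanSpace ℝ (α ⊕ β) →L[ℝ] F))) := by
    classical
    induction s using Finset.induction_on with
    | empty => exact continuous_const (y := (0 : ℝ))
    | insert i s _ ih =>
      rw [Finset.sup_insert, Seminorm.coe_sup]
      exact ((schwartz_withSeminorms ℂ _ _).continuous_seminorm i).sup ih
  have hq : Continuous q := hc.comp (pfiDeriv (α := α) (β := β) (F := F)).continuous
  obtain ⟨t, C, -, hC⟩ := Seminorm.bound_of_continuous (schwartz_withSeminorms ℂ _ F) q hq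
  exact ⟨t, C, C.2, fun f => hC f⟩

theorem pfiFun_bound (k n : ℕ) : ∀ (F : Type) [NormedAddCommGroup F] [NormedSpace ℂ F],
    ∃ (s : Finset (ℕ × ℕ)) (C : ℝ), 0 ≤ C ∧ ∀ (f : 𝓢(EuclideanSpace ℝ (α ⊕ β), F))
      (z : EuclideanSpace ℝ (α ⊕ β)),
      ‖z‖ ^ k * ‖iteratedFDeriv ℝ n (pfiFun f) z‖ ≤
        C * s.sup (schwartzSeminormFamily ℂ (EuclideanSpace ℝ (α ⊕ β)) F) f := by
  induction n with
  | zero =>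
    intro F _ _
    simp only [norm_iteratedFDeriv_zero]
    exact pfiFun_bound_zero k
  | succ n ih =>
    intro F _ _
    obtain ⟨s, C, hC, h⟩ := ih (EuclideanSpace ℝ (α ⊕ β) →L[ℝ] F)
    obtain ⟨t, D, hD, h'⟩ := pfiDeriv_sup_bound (α := α) (β := β) (F := F) s
    refine ⟨t, C * D, by positivity, fun f z => ?_⟩
    have e : fderiv ℝ (pfiFun f) = pfiFun (pfiDeriv f) := by
      ext1 z; exact (hasFDerivAt_pfiFun f z).fderiv
    rw [← norm_iteratedFDeriv_fderiv, e]
    refine (h (pfiDeriv f) z).trans ?_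
    rw [mul_assoc]
    exact mul_le_mul_of_nonneg_left (h' f) hC

/-- The inverse Fourier transform in the second variable on Schwartz functions,
`(𝓕₂⁻¹ f)(x, y) = ∫ exp(2πi η·y) f(x, η) dη`. -/
def partialFourierInvS :
    𝓢(EuclideanSpace ℝ (α ⊕ β), ℂ) →L[ℂ] 𝓢(EuclideanSpace ℝ (α ⊕ β), ℂ) :=
  SchwartzMap.mkCLM (σ := RingHom.id ℂ)
    (fun f z => ∫ η : EuclideanSpace ℝ β,
      Real.fourierChar (inner ℝ η (sndE z)) • f (pairE (fstE z) η))
    (fun f g z => by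
      rw [← integral_add (slice_integrable f z) (slice_integrable g z)]
      simp [smul_add])
    (fun c f z => by
      rw [RingHom.id_apply, ← integral_smul]
      exact integral_congr_ae (Filter.Eventually.of_forall fun η =>
        smul_comm (Real.fourierChar (inner ℝ η (sndE z))) c (f (pairE (fstE z) η))))
    (fun f => contDiff_infty.mpr fun n => contDiff_pfiFun n f)
    (fun n => pfiFun_bound n.1 n.2 ℂ)

end partialFourier

/-! ### Conjugation, brackets and operations on tempered distributions -/

section distributions

/-- The complex conjugate of a Schwartz function. -/
def conjS {V : Type} [NormedAddCommGroup V] [NormedSpace ℝ V] (f : 𝓢(V, ℂ)) : 𝓢(V, ℂ) :=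
  SchwartzMap.postcompCLM (𝕜 := ℝ) (Complex.conjCLE : ℂ →L[ℝ] ℂ) f

@[simp] theorem conjS_apply {V : Type} [NormedAddCommGroup V] [NormedSpace ℝ V] (f : 𝓢(V, ℂ))
    (x : V) : conjS f x = (starRingEnd ℂ) (f x) := rfl

/-- The bracket `⟨u, g⟩` on `𝓢' × 𝓢`, conjugate-linear in the second component, which extends
`⟨f, g⟩ = ∫ f(t) conj(g(t)) dt`. (Mathlib's `u g` is the bilinear pairing.) -/
def bracket {V : Type} [NormedAddCommGroup V] [NormedSpace ℝ V] (u : 𝓢'(V, ℂ)) (g : 𝓢(V, ℂ)) : ℂ :=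
  u (conjS g)

/-- `𝓕₂⁻¹ a` for a tempered distribution `a`, by transposition. -/
def partialFourierInv {α β : Type} [Fintype α] [Fintype β]
    (a : 𝓢'(EuclideanSpace ℝ (α ⊕ β), ℂ)) : 𝓢'(EuclideanSpace ℝ (α ⊕ β), ℂ) :=
  PointwiseConvergenceCLM.precomp ℂ partialFourierInvS a

/-- The translation `T_c u = u(· - c)` of a tempered distribution. -/
def translate {V : Type} [NormedAddCommGroup V] [NormedSpace ℝ V] (c : V) (u : 𝓢'(V, ℂ)) :
    𝓢'(V, ℂ) :=
  PointwiseConvergenceCLM.precomp ℂ (SchwartzMap.compSubConstCLM ℂ (-c)) u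

variable {ι : Type} [Fintype ι] [DecidableEq ι]

/-- The action of a square matrix on Euclidean space. -/
def act (M : Matrix ι ι ℝ) : EuclideanSpace ℝ ι →L[ℝ] EuclideanSpace ℝ ι :=
  Matrix.toEuclideanCLM (𝕜 := ℝ) M

/-- The linear change of variables given by an invertible matrix. -/
def actGL (M : GL ι ℝ) : EuclideanSpace ℝ ι ≃L[ℝ] EuclideanSpace ℝ ι :=
  ContinuousLinearEquiv.equivOfInverse (act M) (act (M⁻¹ : GL ι ℝ))
    (fun x => by
      have h : act ((M⁻¹ : GL ι ℝ) : Matrix ι ι ℝ) * act (M : Matrix ι ι ℝ) = 1 := by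
        rw [act, act, ← map_mul, ← Units.val_mul, inv_mul_cancel, Units.val_one, map_one]
      exact DFunLike.congr_fun h x)
    (fun x => by
      have h : act (M : Matrix ι ι ℝ) * act ((M⁻¹ : GL ι ℝ) : Matrix ι ι ℝ) = 1 := by
        rw [act, act, ← map_mul, ← Units.val_mul, mul_inv_cancel, Units.val_one, map_one]
      exact DFunLike.congr_fun h x)

/-- The composition `u(M ·)` of a tempered distribution with an invertible matrix:
`∫ u(M z) h(z) dz = |det M|⁻¹ ∫ u(z) h(M⁻¹ z) dz`. -/
def compGL (M : GL ι ℝ) (u : 𝓢'(EuclideanSpace ℝ ι, ℂ)) : 𝓢'(EuclideanSpace ℝ ι, ℂ) :=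
  ((|(M : Matrix ι ι ℝ).det|⁻¹ : ℝ) : ℂ) •
    PointwiseConvergenceCLM.precomp ℂ
      (SchwartzMap.compCLMOfContinuousLinearEquiv ℂ (actGL M).symm) u

/-- The convolution `a * Φ` of a tempered distribution with a Schwartz function:
`∫ (a * Φ)(z) h(z) dz = ∫ a(u) (∫ Φ(z - u) h(z) dz) du`, the inner integral being
the convolution of `Φ(-·)` and `h`. -/
def convDist (a : 𝓢'(EuclideanSpace ℝ ι, ℂ)) (Φ : 𝓢(EuclideanSpace ℝ ι, ℂ)) :
    𝓢'(EuclideanSpace ℝ ι, ℂ) :=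
  PointwiseConvergenceCLM.precomp ℂ
    (SchwartzMap.convolution (ContinuousLinearMap.mul ℂ ℂ)
      (SchwartzMap.compCLMOfContinuousLinearEquiv ℂ
        (ContinuousLinearEquiv.neg ℝ (M := EuclideanSpace ℝ ι)) Φ)) a

/-- `k` is the integral `∫ K_t dt` of a family of tempered distributions, in the weak sense. -/
def IsWeakIntegral {d : ℕ} (K : EuclideanSpace ℝ (Fin d) → 𝓢'(EuclideanSpace ℝ ι, ℂ))
    (k : 𝓢'(EuclideanSpace ℝ ι, ℂ)) : Prop :=
  ∀ h : 𝓢(EuclideanSpace ℝ ι, ℂ), Integrable (fun t => bracket (K t) h) ∧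
    bracket k h = ∫ t, bracket (K t) h

end distributions

/-! ### Metaplectic operators -/

section metaplectic
variable {ι : Type} [Fintype ι]

/-- `L²(ℝ^ι)`. -/
abbrev L2 (ι : Type) [Fintype ι] := Lp ℂ 2 (volume : Measure (EuclideanSpace ℝ ι))

/-- The function `ρ(x, ξ; τ) f = exp(2πiτ) exp(-πi ξ·x) exp(2πi ξ·t) f(t - x)`. -/
def schrodingerFun (x ξ : EuclideanSpace ℝ ι) (τ : ℝ) (f : EuclideanSpace ℝ ι → ℂ)
    (t : EuclideanSpace ℝ ι) : ℂ :=
  Complex.exp (2 * Real.pi * τ * Complex.I) *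
    Complex.exp (-(Real.pi * (inner ℝ ξ x : ℝ) * Complex.I)) *
      (Complex.exp (2 * Real.pi * (inner ℝ ξ t : ℝ) * Complex.I) * f (t - x))

theorem memLp_schrodingerFun (x ξ : EuclideanSpace ℝ ι) (τ : ℝ) (f : L2 ι) :
    MemLp (schrodingerFun x ξ τ f) 2 volume := by
  have h1 : MemLp (fun t => f (t - x)) 2 volume :=
    (Lp.memLp f).comp_measurePreserving (measurePreserving_sub_right volume x)
  have hm : AEStronglyMeasurable (schrodingerFun x ξ τ f) volume := by
    refine AEStronglyMeasurable.mul aestronglyMeasurable_const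
      (AEStronglyMeasurable.mul (Continuous.aestronglyMeasurable ?_) h1.1)
    fun_prop
  refine h1.of_le hm (Filter.Eventually.of_forall fun t => le_of_eq ?_)
  have e1 : ‖Complex.exp (2 * Real.pi * τ * Complex.I)‖ = 1 := by
    have := Complex.norm_exp_ofReal_mul_I (2 * Real.pi * τ)
    push_cast at this; exact this
  have e2 : ‖Complex.exp (-(Real.pi * (inner ℝ ξ x : ℝ) * Complex.I))‖ = 1 := by
    have := Complex.norm_exp_ofReal_mul_I (-(Real.pi * (inner ℝ ξ x : ℝ)))
    push_cast at this; rw [neg_mul] at this; exact this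
  have e3 : ‖Complex.exp (2 * Real.pi * (inner ℝ ξ t : ℝ) * Complex.I)‖ = 1 := by
    have := Complex.norm_exp_ofReal_mul_I (2 * Real.pi * (inner ℝ ξ t : ℝ))
    push_cast at this; exact this
  rw [schrodingerFun, norm_mul, norm_mul, norm_mul, e1, e2, e3]
  ring

/-- The Schrödinger representation `ρ(x, ξ; τ)` of the Heisenberg group on `L²`. -/
def schrodinger (x ξ : EuclideanSpace ℝ ι) (τ : ℝ) (f : L2 ι) : L2 ι :=
  (memLp_schrodingerFun x ξ τ f).toLp _

variable [DecidableEq ι]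

/-- The unitary operator `U` is a metaplectic operator over the matrix `M`:
`U ρ(x, ξ; τ) U⁻¹ = ρ(M (x, ξ); τ)`. -/
def IsMetaplectic (M : Matrix (ι ⊕ ι) (ι ⊕ ι) ℝ) (U : L2 ι ≃ₗᵢ[ℂ] L2 ι) : Prop :=
  ∀ (w : EuclideanSpace ℝ (ι ⊕ ι)) (τ : ℝ) (f : L2 ι),
    U (schrodinger (fstE w) (sndE w) τ f) =
      schrodinger (fstE (act M w)) (sndE (act M w)) τ (U f)

/-- The matrix `𝒟_E = diag(E⁻¹, Eᵀ)`. -/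
def dilationMatrix (E : GL ι ℝ) : Matrix (ι ⊕ ι) (ι ⊕ ι) ℝ :=
  Matrix.fromBlocks ((E⁻¹ : GL ι ℝ) : Matrix ι ι ℝ) 0 0 (E : Matrix ι ι ℝ)ᵀ

/-- The matrix `𝒜_FT2` of the partial Fourier transform in the second variable, with rows
`(I, 0, 0, 0)`, `(0, 0, 0, I)`, `(0, 0, I, 0)`, `(0, -I, 0, 0)`. -/
def AFT2 (d : ℕ) : Matrix ((Fin d ⊕ Fin d) ⊕ (Fin d ⊕ Fin d))
    ((Fin d ⊕ Fin d) ⊕ (Fin d ⊕ Fin d)) ℝ :=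
  Matrix.fromBlocks
    (Matrix.fromBlocks 1 0 0 0) (Matrix.fromBlocks 0 0 0 1)
    (Matrix.fromBlocks 0 0 0 (-1)) (Matrix.fromBlocks 1 0 0 0)

end metaplectic

/-! ### Metaplectic Wigner distributions, operators and kernels -/

section localization
variable {d : ℕ}

/-- `ℝ^d`. -/
abbrev Rd (d : ℕ) := EuclideanSpace ℝ (Fin d)

/-- `ℝ^{2d}`, with points `(x, y)`. -/
abbrev R2d (d : ℕ) := EuclideanSpace ℝ (Fin d ⊕ Fin d)

/-- The symplectic matrix `𝒜` is totally Wigner-decomposable, with decomposition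
`𝒜 = 𝒜_FT2 𝒟_E`. -/
def IsWignerDecomposition (𝒜 : Matrix.symplecticGroup (Fin d ⊕ Fin d) ℝ)
    (E : GL (Fin d ⊕ Fin d) ℝ) : Prop :=
  (𝒜 : Matrix _ _ ℝ) = AFT2 d * dilationMatrix E

/-- The Schwartz function `W` is the metaplectic Wigner distribution `U(f ⊗ conj g)`. -/
def IsMetaWigner (U : L2 (Fin d ⊕ Fin d) ≃ₗᵢ[ℂ] L2 (Fin d ⊕ Fin d)) (f g : 𝓢(Rd d, ℂ))
    (W : 𝓢(R2d d, ℂ)) : Prop :=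
  W.toLp 2 = U ((tensor f (conjS g)).toLp 2)

open Classical in
/-- The metaplectic Wigner distribution `W_𝒜(f, g) = U(f ⊗ conj g)` of Schwartz functions, as
the (unique) Schwartz function which represents this element of `L²`. -/
def metaWigner (U : L2 (Fin d ⊕ Fin d) ≃ₗᵢ[ℂ] L2 (Fin d ⊕ Fin d)) (f g : 𝓢(Rd d, ℂ)) :
    𝓢(R2d d, ℂ) :=
  if h : ∃ W, IsMetaWigner U f g W then h.choose else 0

/-- `T` is the metaplectic pseudodifferential operator with symbol `σ`:
`⟨T f, g⟩ = ⟨σ, W_𝒜(g, f)⟩`. -/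
def IsMetaOp (U : L2 (Fin d ⊕ Fin d) ≃ₗᵢ[ℂ] L2 (Fin d ⊕ Fin d)) (σ : 𝓢'(R2d d, ℂ))
    (T : 𝓢(Rd d, ℂ) →L[ℂ] 𝓢'(Rd d, ℂ)) : Prop :=
  ∀ f g : 𝓢(Rd d, ℂ), bracket (T f) g = bracket σ (metaWigner U g f)

open Classical in
/-- The metaplectic pseudodifferential operator `Op_𝒜(σ) : 𝓢 → 𝓢'`, i.e. the (unique) operator
with `⟨Op_𝒜(σ) f, g⟩ = ⟨σ, W_𝒜(g, f)⟩`. -/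
def metaOp (U : L2 (Fin d ⊕ Fin d) ≃ₗᵢ[ℂ] L2 (Fin d ⊕ Fin d)) (σ : 𝓢'(R2d d, ℂ)) :
    𝓢(Rd d, ℂ) →L[ℂ] 𝓢'(Rd d, ℂ) :=
  if h : ∃ T, IsMetaOp U σ T then h.choose else 0

/-- The symbol `a * W_𝒜(φ₂, φ₁)`. -/
def locSymbol (U : L2 (Fin d ⊕ Fin d) ≃ₗᵢ[ℂ] L2 (Fin d ⊕ Fin d)) (a : 𝓢'(R2d d, ℂ))
    (φ₁ φ₂ : 𝓢(Rd d, ℂ)) : 𝓢'(R2d d, ℂ) :=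
  convDist a (metaWigner U φ₂ φ₁)

/-- The `𝒜`-localization operator `A_{a,𝒜}^{φ₁,φ₂} = Op_𝒜(a * W_𝒜(φ₂, φ₁))`. -/
def locOp (U : L2 (Fin d ⊕ Fin d) ≃ₗᵢ[ℂ] L2 (Fin d ⊕ Fin d)) (a : 𝓢'(R2d d, ℂ))
    (φ₁ φ₂ : 𝓢(Rd d, ℂ)) : 𝓢(Rd d, ℂ) →L[ℂ] 𝓢'(Rd d, ℂ) :=
  metaOp U (locSymbol U a φ₁ φ₂)

/-- `k` is a Schwartz kernel of `T`: `⟨T f, g⟩ = ⟨k, g ⊗ conj f⟩`. -/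
def IsSchwartzKernel (T : 𝓢(Rd d, ℂ) →L[ℂ] 𝓢'(Rd d, ℂ)) (k : 𝓢'(R2d d, ℂ)) : Prop :=
  ∀ f g : 𝓢(Rd d, ℂ), bracket (T f) g = bracket k (tensor g (conjS f))

/-- The function
`(x, y) ↦ φ₂(A t + B (C' x + D' y)) conj(φ₁(C t + D (C' x + D' y)))`. -/
def windowFactor (A B C D C' D' : Matrix (Fin d) (Fin d) ℝ) (φ₁ φ₂ : 𝓢(Rd d, ℂ)) (t : Rd d)
    (z : R2d d) : ℂ :=
  φ₂ (act A t + act B (act C' (fstE z) + act D' (sndE z))) *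
    (starRingEnd ℂ) (φ₁ (act C t + act D (act C' (fstE z) + act D' (sndE z))))

theorem windowFactor_hasTemperateGrowth (A B C D C' D' : Matrix (Fin d) (Fin d) ℝ)
    (φ₁ φ₂ : 𝓢(Rd d, ℂ)) (t : Rd d) :
    (windowFactor A B C D C' D' φ₁ φ₂ t).HasTemperateGrowth := by
  have h : ∀ (φ : 𝓢(Rd d, ℂ)) (P Q : Matrix (Fin d) (Fin d) ℝ), Function.HasTemperateGrowth
      fun z : R2d d => φ (act P t + act Q (act C' (fstE z) + act D' (sndE z))) := by
    intro φ P Q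
    have h1 : Function.HasTemperateGrowth
        fun z : R2d d => act P t + act Q (act C' (fstE z) + act D' (sndE z)) := by
      fun_prop
    exact φ.hasTemperateGrowth.comp h1
  exact (h φ₂ A B).mul (h (conjS φ₁) C D)

/-- The tempered distribution
`(T_{(t,0)} 𝓕₂⁻¹ a)(E⁻¹(x, y)) φ₂(A t + B (C' x + D' y)) conj(φ₁(C t + D (C' x + D' y)))`
in `(x, y)`, for fixed `t`. -/
def kernelIntegrand (E : GL (Fin d ⊕ Fin d) ℝ) (A B C D C' D' : Matrix (Fin d) (Fin d) ℝ)
    (a : 𝓢'(R2d d, ℂ)) (φ₁ φ₂ : 𝓢(Rd d, ℂ)) (t : Rd d) : 𝓢'(R2d d, ℂ) :=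
  TemperedDistribution.smulLeftCLM ℂ (windowFactor A B C D C' D' φ₁ φ₂ t)
    (compGL E⁻¹ (translate (pairE t 0) (partialFourierInv a)))

end localization

end

end MetaLoc

open MetaLoc

/-! Up to a phase `c`, the operator `U` is explicit: on Schwartz functions it is `c • metaS E`,
where `metaS E` sends `f` to `|det E|^{1/2} 𝓕₂(f ∘ E)`. Indeed `metaS E` is an `L²` isometry with
the same intertwining relation as `U`, so `U⁻¹ ∘ metaS E` commutes with the Schrödinger
representation and is a scalar by Schur's lemma (`exists_eq_smul_of_commute`, `exists_phase`). Hence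
`W_𝒜(f, g)` is Schwartz. Transposing `metaS E` turns `⟨σ, W_𝒜(g, f)⟩` into the pairing of one fixed
tempered distribution, `metaKernel E c σ`, with `g ⊗ conj f`. This gives existence of the kernel;
uniqueness holds because a tempered distribution is determined by its values on tensor products
(`eq_zero_of_apply_tensor_eq_zero`).

For the formula take `σ = a * W_𝒜(φ₂, φ₁)` and put `Φ = (φ₂ ⊗ conj φ₁) ∘ E`, `β = h ∘ E`. The window
contributes `c`, the transposed operator `conj c`, and each contributes `|det E|^{1/2}`, so the
kernel applied to `h` is `|det E|` times `a` applied to the convolution of `(𝓕₂ Φ)(-·)` with `𝓕₂⁻¹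
β`. In the second variable the Fourier transform turns this convolution into a product, so it equals
`𝓕₂⁻¹` of `(x, y) ↦ ∫ Φ(t, y) β(x + t, y) dt` (`convolution_partialFourierS`). For fixed `t`,
unwinding the definition of the integrand gives `|det E| a(𝓕₂⁻¹ ·)` at `Φ(t, y) β(x + t, y)`
(`kernelIntegrand_apply`).

It remains to exchange a tempered distribution with an integral over a parameter
(`integral_apply_slice`). The distribution is bounded by finitely many seminorms, so by Hahn–Banach
it extends to a Banach space of bounded continuous functions, where the slices of a Schwartz
function are Bochner integrable. The same exchange yields the density of tensor products and the
convolution identity. -/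

namespace MetaLoc
noncomputable section

open scoped LineDeriv

/-! ### Fubini for block vectors -/

section fubini
variable {α β : Type} [Fintype α] [Fintype β]

/-- The splitting `(x, y) ↦ (x, y)` of a Euclidean space into two blocks. -/
def pairCLE : EuclideanSpace ℝ (α ⊕ β) ≃L[ℝ] EuclideanSpace ℝ α × EuclideanSpace ℝ β :=
  ContinuousLinearEquiv.equivOfInverse (fstE.prod sndE) (inlE.coprod inrE)
    (fun z => by
      change inlE (fstE z) + inrE (sndE z) = z
      rw [← pairE_eq, pairE_fstE_sndE])
    (fun p => by
      change (fstE (inlE p.1 + inrE p.2), sndE (inlE p.1 + inrE p.2)) = p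
      rw [← pairE_eq]; rfl)

theorem pairCLE_symm_apply (p : EuclideanSpace ℝ α × EuclideanSpace ℝ β) :
    pairCLE.symm p = pairE p.1 p.2 := (pairE_eq _ _).symm

theorem measurePreserving_pairCLE :
    MeasurePreserving (pairCLE (α := α) (β := β)) volume (volume.prod volume) := by
  have h1 := EuclideanSpace.volume_preserving_symm_measurableEquiv_toLp (α ⊕ β)
  have h2 := measurePreserving_sumPiEquivProdPi fun _ : α ⊕ β => (volume : Measure ℝ)
  have h3 := (EuclideanSpace.volume_preserving_symm_measurableEquiv_toLp α).symm
  have h4 := (EuclideanSpace.volume_preserving_symm_measurableEquiv_toLp β).symm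
  exact (h3.prod h4).comp (h2.comp h1)

theorem measurePreserving_pairE :
    MeasurePreserving (fun p : EuclideanSpace ℝ α × EuclideanSpace ℝ β => pairE p.1 p.2)
      (volume.prod volume) volume := by
  have h : MeasurePreserving (pairCLE (α := α) (β := β)).toHomeomorph.toMeasurableEquiv volume
    (volume.prod volume) := measurePreserving_pairCLE
  have h' := h.symm
  convert! h' using 1
  ext1 p
  exact (pairCLE_symm_apply p).symm

theorem measurableEmbedding_pairE :
    MeasurableEmbedding (fun p : EuclideanSpace ℝ α × EuclideanSpace ℝ β => pairE p.1 p.2) := by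
  convert! (pairCLE (α := α) (β := β)).symm.toHomeomorph.measurableEmbedding using 1
  ext1 p
  exact (pairCLE_symm_apply p).symm

variable {G : Type*} [NormedAddCommGroup G]

theorem integrable_pairE_iff {f : EuclideanSpace ℝ (α ⊕ β) → G} :
    Integrable (fun p : EuclideanSpace ℝ α × EuclideanSpace ℝ β => f (pairE p.1 p.2))
      (volume.prod volume) ↔ Integrable f :=
  measurePreserving_pairE.integrable_comp_emb measurableEmbedding_pairE

theorem integral_eq_integral_pairE [NormedSpace ℝ G] {f : EuclideanSpace ℝ (α ⊕ β) → G}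
    (hf : Integrable f) : ∫ z, f z = ∫ x, ∫ y, f (pairE x y) := by
  rw [← measurePreserving_pairE.integral_comp measurableEmbedding_pairE f]
  exact integral_prod _ (integrable_pairE_iff.mpr hf)

end fubini

/-! ### Partial integrals and slices of Schwartz functions -/

section marginal
variable {α β : Type} [Fintype α] [Fintype β]

/-- The exchange of blocks `(x, y) ↦ (y, x)`. -/
def swapE : EuclideanSpace ℝ (α ⊕ β) ≃L[ℝ] EuclideanSpace ℝ (β ⊕ α) :=
  ContinuousLinearEquiv.equivOfInverse (inlE ∘L sndE + inrE ∘L fstE)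
    (inlE ∘L sndE + inrE ∘L fstE)
    (fun z => by
      change inlE (sndE (inlE (sndE z) + inrE (fstE z))) +
        inrE (fstE (inlE (sndE z) + inrE (fstE z))) = z
      rw [← pairE_eq, ← pairE_eq]; simp)
    (fun z => by
      change inlE (sndE (inlE (sndE z) + inrE (fstE z))) +
        inrE (fstE (inlE (sndE z) + inrE (fstE z))) = z
      rw [← pairE_eq, ← pairE_eq]; simp)

theorem swapE_apply (z : EuclideanSpace ℝ (α ⊕ β)) : swapE z = pairE (sndE z) (fstE z) :=
  (pairE_eq _ _).symm

theorem inlE_eq (x : EuclideanSpace ℝ α) : (inlE x : EuclideanSpace ℝ (α ⊕ β)) = pairE x 0 := rfl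

theorem inrE_eq (y : EuclideanSpace ℝ β) : (inrE y : EuclideanSpace ℝ (α ⊕ β)) = pairE 0 y := rfl

theorem norm_inlE (x : EuclideanSpace ℝ α) : ‖(inlE x : EuclideanSpace ℝ (α ⊕ β))‖ = ‖x‖ := by
  have h := norm_sq_eq (inlE x : EuclideanSpace ℝ (α ⊕ β))
  rw [inlE_eq, fstE_pairE, sndE_pairE, norm_zero] at h
  rw [inlE_eq]
  exact (pow_left_inj₀ (norm_nonneg _) (norm_nonneg _) two_ne_zero).mp (by simpa using h)

/-- The partial integral `y ↦ ∫ H(x, y) dx` of a Schwartz function. -/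
def marginal : 𝓢(EuclideanSpace ℝ (α ⊕ β), ℂ) →L[ℂ] 𝓢(EuclideanSpace ℝ β, ℂ) :=
  -- Integration over `x` is the value at frequency `0` of the inverse Fourier transform in `x`.
  -- That the result is Schwartz, and depends continuously on `H`, is inherited from
  -- `partialFourierInvS`.
  SchwartzMap.compCLM ℂ (g := fun y : EuclideanSpace ℝ β =>
      (inlE y : EuclideanSpace ℝ (β ⊕ α))) (by fun_prop)
      ⟨1, 1, fun y => by rw [norm_inlE]; linarith⟩ ∘L
    partialFourierInvS ∘L SchwartzMap.compCLMOfContinuousLinearEquiv ℂ swapE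

theorem marginal_eq_pfiFun (H : 𝓢(EuclideanSpace ℝ (α ⊕ β), ℂ)) (y : EuclideanSpace ℝ β) :
    marginal H y = pfiFun (SchwartzMap.compCLMOfContinuousLinearEquiv ℂ swapE H) (inlE y) := rfl

theorem marginal_apply (H : 𝓢(EuclideanSpace ℝ (α ⊕ β), ℂ)) (y : EuclideanSpace ℝ β) :
    marginal H y = ∫ x, H (pairE x y) := by
  rw [marginal_eq_pfiFun, pfiFun]
  refine integral_congr_ae (Filter.Eventually.of_forall fun x => ?_)
  simp [inlE_eq, swapE_apply]

theorem lineDerivOp_marginal (H : 𝓢(EuclideanSpace ℝ (α ⊕ β), ℂ)) (m : EuclideanSpace ℝ β) :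
    ∂_{m} (marginal H) = marginal (∂_{(inrE m : EuclideanSpace ℝ (α ⊕ β))} H) := by
  ext y
  set K := SchwartzMap.compCLMOfContinuousLinearEquiv ℂ (swapE (α := β) (β := α)) H with hK
  have h1 : HasFDerivAt (marginal H) (pfiFun (pfiDeriv K) (inlE y) ∘L inlE) y :=
    (hasFDerivAt_pfiFun K (inlE y)).comp y inlE.hasFDerivAt
  rw [lineDerivOp_apply_eq_fderiv, h1.fderiv, marginal_apply, ContinuousLinearMap.comp_apply,
    pfiFun, ContinuousLinearMap.integral_apply (slice_integrable _ _)]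
  refine integral_congr_ae (Filter.Eventually.of_forall fun x => ?_)
  -- At frequency `0` the character is `1` and the multiplication term of `pfiDeriv` vanishes; only
  -- the derivative under the integral survives.
  simp only [inlE_eq, sndE_pairE, fstE_pairE, inner_zero_right, AddChar.map_zero_eq_one, one_smul,
    pfiDeriv_apply, smul_zero, add_zero, zero_smul]
  rw [← lineDerivOp_apply_eq_fderiv, hK, lineDerivOp_compCLMOfContinuousLinearEquiv]
  simp [swapE_apply, inrE_eq]

theorem iteratedLineDerivOp_marginal (H : 𝓢(EuclideanSpace ℝ (α ⊕ β), ℂ)) {n : ℕ}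
    (m : Fin n → EuclideanSpace ℝ β) :
    ∂^{m} (marginal H) =
      marginal (∂^{fun i => (inrE (m i) : EuclideanSpace ℝ (α ⊕ β))} H) := by
  induction n with
  | zero => rfl
  | succ n ih =>
    rw [LineDeriv.iteratedLineDerivOp_succ_left, ih, lineDerivOp_marginal,
      LineDeriv.iteratedLineDerivOp_succ_left]
    rfl

theorem lineDerivOp_slice (H : 𝓢(EuclideanSpace ℝ (α ⊕ β), ℂ)) (x : EuclideanSpace ℝ α)
    (m : EuclideanSpace ℝ β) :
    ∂_{m} (slice x H) = slice x (∂_{(inrE m : EuclideanSpace ℝ (α ⊕ β))} H) := by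
  ext y
  have h1 : HasFDerivAt (fun y : EuclideanSpace ℝ β => inlE x + inrE y)
      (inrE : EuclideanSpace ℝ β →L[ℝ] EuclideanSpace ℝ (α ⊕ β)) y :=
    inrE.hasFDerivAt.const_add _
  have h2 : HasFDerivAt (slice x H) (fderiv ℝ H (pairE x y) ∘L inrE) y := by
    have h3 := H.hasFDerivAt (pairE x y)
    rw [pairE_eq] at h3
    have := HasFDerivAt.comp y h3 h1
    rw [← pairE_eq] at this
    convert! this using 1
    ext1 z
    simp [slice_apply, pairE_eq]
  rw [lineDerivOp_apply_eq_fderiv, h2.fderiv, slice_apply, lineDerivOp_apply_eq_fderiv]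
  rfl

theorem iteratedLineDerivOp_slice (H : 𝓢(EuclideanSpace ℝ (α ⊕ β), ℂ)) (x : EuclideanSpace ℝ α)
    {n : ℕ} (m : Fin n → EuclideanSpace ℝ β) :
    ∂^{m} (slice x H) = slice x (∂^{fun i => (inrE (m i) : EuclideanSpace ℝ (α ⊕ β))} H) := by
  induction n with
  | zero => rfl
  | succ n ih =>
    rw [LineDeriv.iteratedLineDerivOp_succ_left, ih, lineDerivOp_slice,
      LineDeriv.iteratedLineDerivOp_succ_left]
    rfl

/-- Mean value inequality in the slice parameter, at the cost of one more derivative of `H`. It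
makes the slices depend in a Lipschitz way on `x`, which supplies the measurability needed for
Bochner integration. -/
theorem norm_iteratedFDeriv_slice_sub_le (H : 𝓢(EuclideanSpace ℝ (α ⊕ β), ℂ)) (k n : ℕ)
    (x x' : EuclideanSpace ℝ α) (y : EuclideanSpace ℝ β) :
    ‖y‖ ^ k * ‖iteratedFDeriv ℝ n (slice x H) y - iteratedFDeriv ℝ n (slice x' H) y‖ ≤
      SchwartzMap.seminorm ℂ k (n + 1) H * ‖x - x'‖ := by
  have e : ∀ x, iteratedFDeriv ℝ n (slice x H) y =
      (iteratedFDeriv ℝ n H (pairE x y)).compContinuousLinearMap fun _ => inrE := by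
    intro x
    have e : (slice x H : EuclideanSpace ℝ β → ℂ) =
        (fun z => H (inlE x + z)) ∘
          (inrE : EuclideanSpace ℝ β →L[ℝ] EuclideanSpace ℝ (α ⊕ β)) := by
      ext y; simp [slice_apply, pairE_eq]
    have hsm : ContDiff ℝ ∞ (fun z => H (inlE x + z)) :=
      ContDiff.comp (g := H) (H.smooth ⊤) (contDiff_const.add contDiff_id)
    rw [e, inrE.iteratedFDeriv_comp_right hsm y (mod_cast le_top),
      iteratedFDeriv_comp_add_left, ← pairE_eq]
  have h1 : ‖iteratedFDeriv ℝ n (slice x H) y - iteratedFDeriv ℝ n (slice x' H) y‖ ≤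
      ‖iteratedFDeriv ℝ n H (pairE x y) - iteratedFDeriv ℝ n H (pairE x' y)‖ := by
    rw [e, e]
    have e2 : ((iteratedFDeriv ℝ n H (pairE x y)).compContinuousLinearMap fun _ => inrE) -
        ((iteratedFDeriv ℝ n H (pairE x' y)).compContinuousLinearMap fun _ => inrE) =
        (iteratedFDeriv ℝ n H (pairE x y) -
          iteratedFDeriv ℝ n H (pairE x' y)).compContinuousLinearMap
            fun _ => (inrE : EuclideanSpace ℝ β →L[ℝ] EuclideanSpace ℝ (α ⊕ β)) := by
      ext v; simp
    rw [e2]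
    refine (ContinuousMultilinearMap.norm_compContinuousLinearMap_le _ _).trans ?_
    refine mul_le_of_le_one_right (norm_nonneg _) ?_
    exact Finset.prod_le_one (fun _ _ => norm_nonneg _) fun _ _ => norm_inrE_le
  refine (mul_le_mul_of_nonneg_left h1 (by positivity)).trans ?_
  rcases (pow_nonneg (norm_nonneg y) k).eq_or_lt with h0 | h0
  · rw [← h0, zero_mul]; positivity
  rw [← le_div_iff₀' h0, mul_div_right_comm]
  have hp : ∀ x : EuclideanSpace ℝ α, pairE x y = inlE x + inrE y := fun x => pairE_eq x y
  have hd : ∀ x : EuclideanSpace ℝ α, HasFDerivAt (fun x => iteratedFDeriv ℝ n H (pairE x y))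
      (fderiv ℝ (iteratedFDeriv ℝ n H) (pairE x y) ∘L inlE) x := by
    intro x
    have h2 : HasFDerivAt (fun x : EuclideanSpace ℝ α => pairE x y)
        (inlE : EuclideanSpace ℝ α →L[ℝ] EuclideanSpace ℝ (α ⊕ β)) x := by
      simp only [hp]; exact inlE.hasFDerivAt.add_const _
    have h3 : DifferentiableAt ℝ (iteratedFDeriv ℝ n H) (pairE x y) :=
      (H.smooth ⊤).differentiable_iteratedFDeriv (mod_cast ENat.natCast_lt_top n) _
    exact HasFDerivAt.comp (g := iteratedFDeriv ℝ n H) x h3.hasFDerivAt h2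
  have hl : ‖(inlE : EuclideanSpace ℝ α →L[ℝ] EuclideanSpace ℝ (α ⊕ β))‖ ≤ 1 :=
    ContinuousLinearMap.opNorm_le_bound _ zero_le_one fun x => by rw [norm_inlE, one_mul]
  refine Convex.norm_image_sub_le_of_norm_fderiv_le (𝕜 := ℝ) (s := Set.univ)
    (f := fun x => iteratedFDeriv ℝ n H (pairE x y)) (fun x _ => (hd x).differentiableAt)
    (fun x _ => ?_) convex_univ (Set.mem_univ _) (Set.mem_univ _)
  rw [(hd x).fderiv, le_div_iff₀' h0]
  have hy : ‖y‖ ≤ ‖pairE x y‖ := by simpa using norm_sndE_le (pairE x y)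
  calc ‖y‖ ^ k * ‖fderiv ℝ (iteratedFDeriv ℝ n H) (pairE x y) ∘L inlE‖
      ≤ ‖pairE x y‖ ^ k * (‖fderiv ℝ (iteratedFDeriv ℝ n H) (pairE x y)‖ * 1) := by
        gcongr
        refine (ContinuousLinearMap.opNorm_comp_le _ _).trans ?_
        exact mul_le_mul_of_nonneg_left hl (norm_nonneg _)
    _ = ‖pairE x y‖ ^ k * ‖iteratedFDeriv ℝ (n + 1) H (pairE x y)‖ := by
        rw [mul_one, norm_fderiv_iteratedFDeriv]
    _ ≤ _ := SchwartzMap.le_seminorm ℂ _ _ H _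

end marginal

/-! ### Tempered distributions commute with partial integrals -/

section weakIntegral

variable {V : Type} [NormedAddCommGroup V] [NormedSpace ℝ V]

/-- The Banach space of bounded continuous functions with values in `n`-linear forms. -/
def BddForms (V : Type) [NormedAddCommGroup V] [NormedSpace ℝ V] (n : ℕ) : Type :=
  BoundedContinuousFunction V (V [×n]→L[ℝ] ℂ)

instance (n : ℕ) : NormedAddCommGroup (BddForms V n) :=
  inferInstanceAs (NormedAddCommGroup (BoundedContinuousFunction V (V [×n]→L[ℝ] ℂ)))

instance (n : ℕ) : NormedSpace ℂ (BddForms V n) :=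
  inferInstanceAs (NormedSpace ℂ (BoundedContinuousFunction V (V [×n]→L[ℝ] ℂ)))

instance (n : ℕ) : CompleteSpace (BddForms V n) :=
  inferInstanceAs (CompleteSpace (BoundedContinuousFunction V (V [×n]→L[ℝ] ℂ)))

/-- Evaluation of a form-valued function at a point and at vectors. -/
def BddForms.eval (n : ℕ) (y : V) (m : Fin n → V) : BddForms V n →ₗ[ℝ] ℂ where
  toFun w := (show BoundedContinuousFunction V (V [×n]→L[ℝ] ℂ) from w) y m
  map_add' _ _ := rfl
  map_smul' _ _ := rfl

theorem BddForms.norm_le {n : ℕ} {w : BddForms V n} {C : ℝ} (hC : 0 ≤ C) :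
    ‖w‖ ≤ C ↔
      ∀ y, ‖(show BoundedContinuousFunction V (V [×n]→L[ℝ] ℂ) from w) y‖ ≤ C :=
  BoundedContinuousFunction.norm_le hC

theorem BddForms.norm_apply_le {n : ℕ} (w : BddForms V n) (y : V) :
    ‖(show BoundedContinuousFunction V (V [×n]→L[ℝ] ℂ) from w) y‖ ≤ ‖w‖ :=
  BoundedContinuousFunction.norm_coe_le_norm _ y

theorem BddForms.norm_eval_le {n : ℕ} (w : BddForms V n) (y : V) (m : Fin n → V) :
    ‖BddForms.eval n y m w‖ ≤ (∏ i, ‖m i‖) * ‖w‖ := by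
  rw [mul_comm]
  refine (ContinuousMultilinearMap.le_opNorm _ m).trans ?_
  exact mul_le_mul_of_nonneg_right (BddForms.norm_apply_le w y)
    (Finset.prod_nonneg fun _ _ => norm_nonneg _)

/-- Evaluations separate points, so an identity between Bochner integrals can be tested on scalar
integrals. -/
theorem BddForms.ext_eval {n : ℕ} {w w' : BddForms V n}
    (h : ∀ y m, BddForms.eval n y m w = BddForms.eval n y m w') : w = w' :=
  BoundedContinuousFunction.ext fun y => ContinuousMultilinearMap.ext fun m => h y m

/-- A finite product of spaces of bounded continuous functions with values in forms. -/
def BddFormsPi (V : Type) [NormedAddCommGroup V] [NormedSpace ℝ V] (s : Finset (ℕ × ℕ)) : Type :=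
  ∀ i : s, BddForms V i.1.2

instance (s : Finset (ℕ × ℕ)) : NormedAddCommGroup (BddFormsPi V s) :=
  inferInstanceAs (NormedAddCommGroup (∀ i : s, BddForms V i.1.2))

instance (s : Finset (ℕ × ℕ)) : NormedSpace ℂ (BddFormsPi V s) :=
  inferInstanceAs (NormedSpace ℂ (∀ i : s, BddForms V i.1.2))

instance (s : Finset (ℕ × ℕ)) : CompleteSpace (BddFormsPi V s) :=
  inferInstanceAs (CompleteSpace (∀ i : s, BddForms V i.1.2))

theorem BddFormsPi.norm_le {s : Finset (ℕ × ℕ)} {w : BddFormsPi V s} {C : ℝ} (hC : 0 ≤ C) :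
    ‖w‖ ≤ C ↔ ∀ i : s, ‖w i‖ ≤ C := pi_norm_le_iff_of_nonneg hC

theorem BddFormsPi.norm_apply_le {s : Finset (ℕ × ℕ)} (w : BddFormsPi V s) (i : s) :
    ‖w i‖ ≤ ‖w‖ := (BddFormsPi.norm_le (norm_nonneg w)).mp le_rfl i

/-- Evaluation of a component at a point and at vectors. -/
def BddFormsPi.eval {s : Finset (ℕ × ℕ)} (i : s) (y : V) (m : Fin i.1.2 → V) :
    BddFormsPi V s →L[ℝ] ℂ :=
  LinearMap.mkContinuous
    { toFun := fun w => BddForms.eval _ y m (w i)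
      map_add' := fun w w' => (BddForms.eval _ y m).map_add (w i) (w' i)
      map_smul' := fun c w => (BddForms.eval _ y m).map_smul c (w i) }
    (∏ i, ‖m i‖) fun w => (BddForms.norm_eval_le (w i) y m).trans
      (mul_le_mul_of_nonneg_left (BddFormsPi.norm_apply_le w i)
        (Finset.prod_nonneg fun _ _ => norm_nonneg _))

/-- The linear map `g ↦ ‖·‖ᵏ Dⁿg` into bounded continuous functions, whose norm is the Schwartz
seminorm with indices `k` and `n`. -/
def seminormMap (k n : ℕ) :
    𝓢(V, ℂ) →ₗ[ℂ] BddForms V n where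
  toFun g := BoundedContinuousFunction.ofNormedAddCommGroup
    (fun y => ‖y‖ ^ k • iteratedFDeriv ℝ n g y)
    (((continuous_norm).pow k).smul ((g.smooth ⊤).continuous_iteratedFDeriv (mod_cast le_top)))
    (SchwartzMap.seminorm ℂ k n g) (fun y => by
      rw [norm_smul, norm_pow, norm_norm]; exact SchwartzMap.le_seminorm ℂ k n g y)
  map_add' f g := by
    refine BoundedContinuousFunction.ext fun y => ?_
    have h : iteratedFDeriv ℝ n (f + g) y = iteratedFDeriv ℝ n f y + iteratedFDeriv ℝ n g y :=
      iteratedFDeriv_add_apply (f.smooth n).contDiffAt (g.smooth n).contDiffAt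
    change ‖y‖ ^ k • iteratedFDeriv ℝ n (f + g) y =
      ‖y‖ ^ k • iteratedFDeriv ℝ n f y + ‖y‖ ^ k • iteratedFDeriv ℝ n g y
    rw [h, smul_add]
  map_smul' c f := by
    refine BoundedContinuousFunction.ext fun y => ?_
    have h : iteratedFDeriv ℝ n (c • f) y = c • iteratedFDeriv ℝ n f y :=
      iteratedFDeriv_const_smul_apply (f.smooth n).contDiffAt
    change ‖y‖ ^ k • iteratedFDeriv ℝ n (c • f) y = c • ‖y‖ ^ k • iteratedFDeriv ℝ n f y
    rw [h, smul_comm]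

theorem seminorm_le_norm_seminormMap (k n : ℕ) (g : 𝓢(V, ℂ)) :
    SchwartzMap.seminorm ℂ k n g ≤ ‖seminormMap k n g‖ := by
  refine SchwartzMap.seminorm_le_bound ℂ k n g (norm_nonneg _) fun y => ?_
  have h : ‖‖y‖ ^ k • iteratedFDeriv ℝ n g y‖ ≤ _ := (seminormMap k n g).norm_apply_le y
  rwa [norm_smul, norm_pow, norm_norm] at h

theorem norm_seminormMap_le (k n : ℕ) (g : 𝓢(V, ℂ)) :
    ‖seminormMap k n g‖ ≤ SchwartzMap.seminorm ℂ k n g := by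
  refine (BddForms.norm_le (apply_nonneg _ _)).mpr fun y => ?_
  change ‖‖y‖ ^ k • iteratedFDeriv ℝ n g y‖ ≤ _
  rw [norm_smul, norm_pow, norm_norm]
  exact SchwartzMap.le_seminorm ℂ k n g y

/-- The maps `seminormMap k n` for finitely many indices. -/
def seminormsMap (s : Finset (ℕ × ℕ)) : 𝓢(V, ℂ) →ₗ[ℂ] BddFormsPi V s where
  toFun g i := seminormMap i.1.1 i.1.2 g
  map_add' f g := funext fun i => (seminormMap i.1.1 i.1.2).map_add f g
  map_smul' c g := funext fun i => (seminormMap i.1.1 i.1.2).map_smul c g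

/-- A tempered distribution extends to a Banach space of bounded continuous functions. -/
theorem exists_factor_seminormsMap (u : 𝓢(V, ℂ) →L[ℂ] ℂ) :
    ∃ (s : Finset (ℕ × ℕ)) (v : BddFormsPi V s →L[ℂ] ℂ), ∀ g, u g = v (seminormsMap s g) := by
  let q : Seminorm ℂ 𝓢(V, ℂ) := (normSeminorm ℂ ℂ).comp u.toLinearMap
  have hq : Continuous q := continuous_norm.comp u.continuous
  obtain ⟨s, C, -, hC⟩ := Seminorm.bound_of_continuous (schwartz_withSeminorms ℂ V ℂ) q hq
  have hb : ∃ C : ℝ, ∀ g, ‖u.toLinearMap g‖ ≤ C * ‖seminormsMap s g‖ := by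
    refine ⟨C, fun g => (hC g).trans ?_⟩
    change (C : ℝ) * s.sup (schwartzSeminormFamily ℂ V ℂ) g ≤ _
    gcongr
    refine Seminorm.finset_sup_apply_le (norm_nonneg _) fun i hi => ?_
    exact (seminorm_le_norm_seminormMap i.1 i.2 g).trans
      (BddFormsPi.norm_apply_le (seminormsMap s g) ⟨i, hi⟩)
  -- By `hb`, `u` factors through a bounded functional on the range of `seminormsMap s`; Hahn–Banach
  -- extends it to the whole space.
  obtain ⟨v, hv, -⟩ := exists_extension_norm_eq _ (u.toLinearMap.compLeftInverse (seminormsMap s))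
  refine ⟨s, v, fun g => ?_⟩
  have h := hv ⟨seminormsMap s g, LinearMap.mem_range_self _ g⟩
  rw [LinearMap.compLeftInverse_apply_of_bdd _ _ hb g _ rfl] at h
  exact h.symm

variable {α β : Type} [Fintype α] [Fintype β]

theorem continuous_seminormsMap_slice (s : Finset (ℕ × ℕ))
    (H : 𝓢(EuclideanSpace ℝ (α ⊕ β), ℂ)) :
    Continuous fun x : EuclideanSpace ℝ α => seminormsMap s (slice x H) := by
  obtain ⟨C, hC, hCs⟩ : ∃ C : ℝ, 0 ≤ C ∧ ∀ i ∈ s, SchwartzMap.seminorm ℂ i.1 (i.2 + 1) H ≤ C :=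
    ⟨(s.image fun p => (p.1, p.2 + 1)).sup
      (schwartzSeminormFamily ℂ (EuclideanSpace ℝ (α ⊕ β)) ℂ) H, apply_nonneg _ _, fun i hi =>
      seminorm_le_sup (Finset.mem_image_of_mem (fun p : ℕ × ℕ => (p.1, p.2 + 1)) hi) H⟩
  refine (LipschitzWith.of_dist_le_mul (K := C.toNNReal) fun x x' => ?_).continuous
  rw [dist_eq_norm, dist_eq_norm, Real.coe_toNNReal _ hC]
  refine (BddFormsPi.norm_le (by positivity)).mpr fun i => ?_
  refine (BddForms.norm_le (by positivity)).mpr fun y => ?_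
  change ‖‖y‖ ^ i.1.1 • iteratedFDeriv ℝ i.1.2 (slice x H) y -
    ‖y‖ ^ i.1.1 • iteratedFDeriv ℝ i.1.2 (slice x' H) y‖ ≤ _
  rw [← smul_sub, norm_smul, norm_pow, norm_norm]
  refine (norm_iteratedFDeriv_slice_sub_le H _ _ x x' y).trans ?_
  exact mul_le_mul_of_nonneg_right (hCs _ i.2) (norm_nonneg _)

/-- Every power of `‖x‖` can be traded for a higher seminorm of `H`, so the norm of the slice decays
faster than any power. -/
theorem integrable_seminormsMap_slice (s : Finset (ℕ × ℕ))
    (H : 𝓢(EuclideanSpace ℝ (α ⊕ β), ℂ)) :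
    Integrable fun x : EuclideanSpace ℝ α => seminormsMap s (slice x H) := by
  have hb : ∀ j : ℕ, ∀ x : EuclideanSpace ℝ α, ‖x‖ ^ j * ‖seminormsMap s (slice x H)‖ ≤
      (s.image fun p => (j + p.1, p.2)).sup
        (schwartzSeminormFamily ℂ (EuclideanSpace ℝ (α ⊕ β)) ℂ) H := by
    intro j x
    refine le_trans ?_ (slice_sup_bound x H j s)
    gcongr
    refine (BddFormsPi.norm_le (apply_nonneg _ _)).mpr fun i => ?_
    exact (norm_seminormMap_le _ _ _).trans (seminorm_le_sup i.2 (slice x H))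
  have hm := (continuous_seminormsMap_slice s H).aestronglyMeasurable (μ := volume)
  have h := integrable_of_le_of_pow_mul_le (k := 0) (μ := volume) (fun x => by simpa using hb 0 x)
    (hb _) hm
  rw [← integrable_norm_iff hm]
  simpa using h

theorem integrable_apply_slice (u : 𝓢(EuclideanSpace ℝ β, ℂ) →L[ℂ] ℂ)
    (H : 𝓢(EuclideanSpace ℝ (α ⊕ β), ℂ)) :
    Integrable fun x : EuclideanSpace ℝ α => u (slice x H) := by
  obtain ⟨s, v, hv⟩ := exists_factor_seminormsMap u
  simp only [hv]
  exact v.integrable_comp (integrable_seminormsMap_slice s H)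

/-- Tempered distributions commute with partial integrals. -/
theorem integral_apply_slice (u : 𝓢(EuclideanSpace ℝ β, ℂ) →L[ℂ] ℂ)
    (H : 𝓢(EuclideanSpace ℝ (α ⊕ β), ℂ)) :
    ∫ x : EuclideanSpace ℝ α, u (slice x H) = u (marginal H) := by
  obtain ⟨s, v, hv⟩ := exists_factor_seminormsMap u
  simp only [hv]
  have hi := integrable_seminormsMap_slice s H
  rw [v.integral_comp_comm hi]
  congr 1
  -- The Bochner integral of the slices has to be identified with the image of `marginal H`. After
  -- evaluation this is differentiation of `∫ H(x, y) dx` under the integral sign.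
  refine funext fun i => BddForms.ext_eval fun y m => ?_
  have hev : ∀ g : 𝓢(EuclideanSpace ℝ β, ℂ),
      BddFormsPi.eval i y m (seminormsMap s g) = ‖y‖ ^ i.1.1 • (∂^{m} g) y := by
    intro g
    rw [iteratedLineDerivOp_eq_iteratedFDeriv]
    rfl
  change BddFormsPi.eval i y m (∫ x, seminormsMap s (slice x H)) =
    BddFormsPi.eval i y m (seminormsMap s (marginal H))
  rw [← (BddFormsPi.eval i y m).integral_comp_comm hi]
  simp only [hev, iteratedLineDerivOp_slice, iteratedLineDerivOp_marginal, slice_apply,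
    marginal_apply]
  rw [integral_smul]

end weakIntegral

end

end MetaLoc

namespace MetaLoc
noncomputable section

open scoped LineDeriv Topology

/-! ### Approximation by dilated cutoffs -/

section cutoff
variable {V : Type} [NormedAddCommGroup V] [NormedSpace ℝ V]

/-- For `n = 0` this is the mean value inequality between `0` and `s • x`. For `n ≥ 1` the constant
disappears and the chain rule gives `s ^ n ≤ s`. The growth `1 + ‖x‖` is harmless, since one extra
weight on a Schwartz factor absorbs it. -/
theorem norm_iteratedFDeriv_cutoff_sub_one_le (χ : 𝓢(V, ℂ)) (hχ : χ 0 = 1) (n : ℕ) :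
    ∃ C : ℝ, 0 ≤ C ∧ ∀ s : ℝ, 0 < s → s ≤ 1 → ∀ x,
      ‖iteratedFDeriv ℝ n (fun x => χ (s • x) - 1) x‖ ≤ C * s * (1 + ‖x‖) := by
  cases n with
  | zero =>
    refine ⟨SchwartzMap.seminorm ℂ 0 1 χ, apply_nonneg _ _, fun s hs _ x => ?_⟩
    rw [norm_iteratedFDeriv_zero, ← hχ]
    have h := Convex.norm_image_sub_le_of_norm_fderiv_le (𝕜 := ℝ) (s := Set.univ)
      (f := χ) (C := SchwartzMap.seminorm ℂ 0 1 χ) (x := 0) (y := s • x)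
      (fun x _ => χ.differentiableAt) (fun x _ => by
        have := SchwartzMap.norm_iteratedFDeriv_le_seminorm ℂ χ 1 x
        rwa [norm_iteratedFDeriv_one] at this)
      convex_univ (Set.mem_univ _) (Set.mem_univ _)
    refine h.trans ?_
    rw [sub_zero, norm_smul, Real.norm_of_nonneg hs.le, mul_assoc]
    have : 0 ≤ SchwartzMap.seminorm ℂ 0 1 χ := apply_nonneg _ _
    gcongr
    linarith
  | succ n =>
    refine ⟨SchwartzMap.seminorm ℂ 0 (n + 1) χ, apply_nonneg _ _, fun s hs hs1 x => ?_⟩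
    let L : V →L[ℝ] V := s • ContinuousLinearMap.id ℝ V
    have hL : ‖L‖ ≤ s := by
      refine ContinuousLinearMap.opNorm_le_bound _ hs.le fun v => ?_
      change ‖s • v‖ ≤ _
      rw [norm_smul, Real.norm_of_nonneg hs.le]
    have hc : ContDiff ℝ ∞ (χ ∘ L) := (χ.smooth ⊤).comp L.contDiff
    have h1 : iteratedFDeriv ℝ (n + 1) (fun x => χ (s • x) - 1) x =
        iteratedFDeriv ℝ (n + 1) (χ ∘ L) x := by
      have := iteratedFDeriv_sub_apply (𝕜 := ℝ) (i := n + 1) (x := x) (f := χ ∘ L)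
        (g := fun _ : V => (1 : ℂ)) (hc.of_le (mod_cast le_top)).contDiffAt contDiffAt_const
      rw [iteratedFDeriv_succ_const, Pi.zero_apply, sub_zero] at this
      exact this
    rw [h1, L.iteratedFDeriv_comp_right (χ.smooth ⊤) x (mod_cast le_top)]
    refine (ContinuousMultilinearMap.norm_compContinuousLinearMap_le _ _).trans ?_
    rw [Finset.prod_const, Finset.card_univ, Fintype.card_fin, pow_succ, mul_assoc]
    have h2 := SchwartzMap.norm_iteratedFDeriv_le_seminorm ℂ χ (n + 1) (L x)
    have h3 : ‖L‖ ^ n ≤ 1 := pow_le_one₀ (norm_nonneg _) (hL.trans hs1)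
    have h4 : ‖L‖ ^ n * ‖L‖ ≤ s * (1 + ‖x‖) := by
      calc ‖L‖ ^ n * ‖L‖ ≤ 1 * s := by gcongr
        _ ≤ s * (1 + ‖x‖) := by nlinarith [norm_nonneg x]
    exact mul_le_mul h2 h4 (by positivity) (apply_nonneg _ _)

theorem cutoff_hasTemperateGrowth (χ : 𝓢(V, ℂ)) (s : ℝ) :
    Function.HasTemperateGrowth fun x => χ (s • x) :=
  χ.hasTemperateGrowth.comp (s • ContinuousLinearMap.id ℝ V).hasTemperateGrowth

/-- Leibniz rule for `(χ(s ·) - 1) F`; the weight `1 + ‖x‖` accounts for the seminorms of `F` with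
index `k + 1`. -/
theorem seminorm_cutoff_sub_le (χ F : 𝓢(V, ℂ)) (hχ : χ 0 = 1) (k n : ℕ) :
    ∃ C : ℝ, ∀ s : ℝ, 0 < s → s ≤ 1 →
      SchwartzMap.seminorm ℂ k n (smulLeftCLM ℂ (fun x => χ (s • x)) F - F) ≤ C * s := by
  choose C hC0 hC using norm_iteratedFDeriv_cutoff_sub_one_le χ hχ
  refine ⟨∑ i ∈ Finset.range (n + 1), n.choose i * C i *
    (SchwartzMap.seminorm ℂ k (n - i) F + SchwartzMap.seminorm ℂ (k + 1) (n - i) F),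
    fun s hs hs1 => ?_⟩
  have hnn : ∀ i, 0 ≤ n.choose i * C i *
    (SchwartzMap.seminorm ℂ k (n - i) F + SchwartzMap.seminorm ℂ (k + 1) (n - i) F) := fun i =>
    mul_nonneg (mul_nonneg (by positivity) (hC0 i)) (by positivity)
  refine SchwartzMap.seminorm_le_bound ℂ k n _
    (mul_nonneg (Finset.sum_nonneg fun i _ => hnn i) hs.le) fun x => ?_
  have e : ⇑(smulLeftCLM ℂ (fun x => χ (s • x)) F - F) =
      fun x => (χ (s • x) - 1) * F x := by
    ext x
    rw [sub_apply, smulLeftCLM_apply_apply (cutoff_hasTemperateGrowth χ s), smul_eq_mul]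
    ring
  rw [e]
  have hsm : ContDiff ℝ ∞ fun x => χ (s • x) - 1 :=
    (cutoff_hasTemperateGrowth χ s).1.sub contDiff_const
  have h1 := norm_iteratedFDeriv_mul_le (𝕜 := ℝ) (A := ℂ) (N := ∞)
    (f := fun x => χ (s • x) - 1) (g := F) hsm (F.smooth ⊤) x (n := n) (mod_cast le_top)
  refine (mul_le_mul_of_nonneg_left h1 (by positivity)).trans ?_
  rw [Finset.mul_sum, Finset.sum_mul]
  refine Finset.sum_le_sum fun i _ => ?_
  have h2 := hC i s hs hs1 x
  have h3 := SchwartzMap.le_seminorm ℂ k (n - i) F x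
  have h4 := SchwartzMap.le_seminorm ℂ (k + 1) (n - i) F x
  set b := ‖iteratedFDeriv ℝ (n - i) F x‖
  calc _ ≤ ‖x‖ ^ k * (n.choose i * (C i * s * (1 + ‖x‖)) * b) := by gcongr
    _ = n.choose i * C i * (‖x‖ ^ k * b + ‖x‖ ^ (k + 1) * b) * s := by ring
    _ ≤ _ := by
        have := hC0 i
        gcongr

theorem tendsto_cutoff (χ F : 𝓢(V, ℂ)) (hχ : χ 0 = 1) :
    Filter.Tendsto (fun s : ℝ => smulLeftCLM ℂ (fun x => χ (s • x)) F) (𝓝[>] 0) (𝓝 F) := by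
  refine ((schwartz_withSeminorms ℂ V ℂ).tendsto_nhds _ F).mpr fun i ε hε => ?_
  obtain ⟨C, hC⟩ := seminorm_cutoff_sub_le χ F hχ i.1 i.2
  have h1 : Filter.Tendsto (fun s : ℝ => C * s) (𝓝[>] 0) (𝓝 0) := by
    have : Filter.Tendsto (fun s : ℝ => C * s) (𝓝 0) (𝓝 (C * 0)) :=
      (continuous_const.mul continuous_id).tendsto 0
    rw [mul_zero] at this
    exact this.mono_left nhdsWithin_le_nhds
  have h2 : ∀ᶠ s : ℝ in 𝓝[>] 0, s ∈ Set.Ioc (0 : ℝ) 1 := Ioc_mem_nhdsGT zero_lt_one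
  filter_upwards [h1.eventually_lt_const hε, h2] with s hs hs2
  exact (hC s hs2.1 hs2.2).trans_lt hs

/-- Serves both as the profile of the cutoffs and as a nonzero element of `L²` for normalizing
scalars. -/
theorem exists_schwartz_apply_zero (V : Type) [NormedAddCommGroup V] [InnerProductSpace ℝ V]
    [FiniteDimensional ℝ V] : ∃ χ : 𝓢(V, ℂ), χ 0 = 1 := by
  let b : ContDiffBump (0 : V) := ⟨1, 2, one_pos, one_lt_two⟩
  have hs : HasCompactSupport fun x : V => (b x : ℂ) := 
    b.hasCompactSupport.comp_left Complex.ofReal_zero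
  have hc : ContDiff ℝ ∞ fun x : V => (b x : ℂ) := Complex.ofRealCLM.contDiff.comp b.contDiff
  refine ⟨hs.toSchwartzMap hc, ?_⟩
  have : b 0 = 1 := b.one_of_mem_closedBall (Metric.mem_closedBall_self zero_le_one)
  change ((b 0 : ℝ) : ℂ) = 1
  rw [this, Complex.ofReal_one]

end cutoff

/-! ### Characters and modulations -/

section character

theorem hasTemperateGrowth_fourierChar :
    Function.HasTemperateGrowth fun r : ℝ => (Real.fourierChar r : ℂ) := by
  have e : (fun r : ℝ => (Real.fourierChar r : ℂ)) =
      fun r : ℝ => Complex.exp ((2 * Real.pi * Complex.I) * r) := by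
    ext r; rw [Real.fourierChar_apply]; congr 1; push_cast; ring
  have hd : ∀ n : ℕ, iteratedDeriv n (fun r : ℝ => (Real.fourierChar r : ℂ)) =
      fun r => (2 * Real.pi * Complex.I) ^ n * (Real.fourierChar r : ℂ) := by
    intro n
    induction n with
    | zero => simp
    | succ n ih =>
      rw [iteratedDeriv_succ, ih]
      ext r
      have := (Real.hasDerivAt_fourierChar r).const_mul ((2 * Real.pi * Complex.I) ^ n)
      rw [this.deriv]
      ring
  refine ⟨?_, fun n => ⟨0, ‖(2 * Real.pi * Complex.I : ℂ) ^ n‖, fun r => ?_⟩⟩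
  · rw [e]
    exact (contDiff_const.mul Complex.ofRealCLM.contDiff).cexp
  · rw [norm_iteratedFDeriv_eq_norm_iteratedDeriv, hd, norm_mul, Circle.norm_coe, pow_zero]

variable {V : Type} [NormedAddCommGroup V] [InnerProductSpace ℝ V]

theorem hasTemperateGrowth_fourierChar_inner (ξ : V) :
    Function.HasTemperateGrowth fun t : V => (Real.fourierChar (inner ℝ ξ t) : ℂ) :=
  hasTemperateGrowth_fourierChar.comp (innerSL ℝ ξ).hasTemperateGrowth

/-- The modulation `t ↦ exp(2πi ξ·t) f(t)` of a Schwartz function. -/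
def modulate (ξ : V) : 𝓢(V, ℂ) →L[ℂ] 𝓢(V, ℂ) :=
  smulLeftCLM ℂ fun t : V => (Real.fourierChar (inner ℝ ξ t) : ℂ)

theorem modulate_apply (ξ : V) (f : 𝓢(V, ℂ)) (t : V) :
    modulate ξ f t = Real.fourierChar (inner ℝ ξ t) * f t :=
  smulLeftCLM_apply_apply (hasTemperateGrowth_fourierChar_inner ξ) f t

end character

/-! ### Density of tensor products -/

section density
variable {α β : Type} [Fintype α] [Fintype β]

theorem inner_eq_add (z w : EuclideanSpace ℝ (α ⊕ β)) :
    inner ℝ z w = inner ℝ (fstE z) (fstE w) + inner ℝ (sndE z) (sndE w) := by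
  simp [PiLp.inner_apply]

/-- By Fourier inversion, `(f ⊗ g) F` is a superposition of the functions `exp(2πi ζ·z) f(x) g(y)`
with weight `(𝓕 F)(ζ)`. A character of the sum space splits, so each of these is a tensor product
and is annihilated by `u`. The factor `f ⊗ g` makes the integrand `H` Schwartz jointly in `(ζ, z)`,
so `u` may be taken inside the integral. -/
theorem apply_tensor_mul_eq_zero (u : 𝓢(EuclideanSpace ℝ (α ⊕ β), ℂ) →L[ℂ] ℂ)
    (hu : ∀ f g, u (tensor f g) = 0) (f : 𝓢(EuclideanSpace ℝ α, ℂ)) (g : 𝓢(EuclideanSpace ℝ β, ℂ))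
    (F : 𝓢(EuclideanSpace ℝ (α ⊕ β), ℂ)) : u (smulLeftCLM ℂ (tensor f g) F) = 0 := by
  have hg : Function.HasTemperateGrowth
      fun w : EuclideanSpace ℝ ((α ⊕ β) ⊕ (α ⊕ β)) =>
        (Real.fourierChar (inner ℝ (fstE w) (sndE w)) : ℂ) := by
    refine hasTemperateGrowth_fourierChar.comp ?_
    have h1 : Function.HasTemperateGrowth fun w : EuclideanSpace ℝ ((α ⊕ β) ⊕ (α ⊕ β)) =>
      (fstE w : EuclideanSpace ℝ (α ⊕ β)) := by fun_prop
    have h2 : Function.HasTemperateGrowth fun w : EuclideanSpace ℝ ((α ⊕ β) ⊕ (α ⊕ β)) =>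
      (sndE w : EuclideanSpace ℝ (α ⊕ β)) := by fun_prop
    exact (innerSL ℝ (E := EuclideanSpace ℝ (α ⊕ β))).bilinear_hasTemperateGrowth h1 h2
  let H : 𝓢(EuclideanSpace ℝ ((α ⊕ β) ⊕ (α ⊕ β)), ℂ) := smulLeftCLM ℂ
    (fun w => (Real.fourierChar (inner ℝ (fstE w) (sndE w)) : ℂ)) (tensor (𝓕 F) (tensor f g))
  have hH : ∀ ζ z, H (pairE ζ z) =
      Real.fourierChar (inner ℝ ζ z) * ((𝓕 F : 𝓢(_, ℂ)) ζ * (f (fstE z) * g (sndE z))) := by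
    intro ζ z
    rw [smulLeftCLM_apply_apply hg, smul_eq_mul, tensor_apply, tensor_apply, fstE_pairE,
      sndE_pairE]
  have hs : ∀ ζ, slice ζ H = (𝓕 F : 𝓢(_, ℂ)) ζ •
      tensor (modulate (fstE ζ) f) (modulate (sndE ζ) g) := by
    intro ζ
    ext z
    rw [slice_apply, hH, smul_apply, tensor_apply, modulate_apply, modulate_apply, inner_eq_add,
      AddChar.map_add_eq_mul, Circle.coe_mul, smul_eq_mul]
    ring
  have hm : marginal H = smulLeftCLM ℂ (tensor f g) F := by
    ext z
    rw [marginal_apply, smulLeftCLM_apply_apply (tensor f g).hasTemperateGrowth, tensor_apply]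
    have h1 : F z = (𝓕⁻ (𝓕 F) : 𝓢(_, ℂ)) z := by rw [fourierInv_fourier_eq]
    rw [h1, SchwartzMap.fourierInv_coe, Real.fourierInv_eq, smul_eq_mul, mul_comm,
      ← integral_mul_const]
    refine integral_congr_ae (Filter.Eventually.of_forall fun ζ => ?_)
    simp only [hH, Circle.smul_def, smul_eq_mul]
    ring
  rw [← hm, ← integral_apply_slice]
  simp [hs, hu]

/-- A tempered distribution is determined by its values on tensor products. -/
theorem eq_zero_of_apply_tensor_eq_zero (u : 𝓢(EuclideanSpace ℝ (α ⊕ β), ℂ) →L[ℂ] ℂ)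
    (hu : ∀ f g, u (tensor f g) = 0) : u = 0 := by
  ext F
  obtain ⟨f, hf⟩ := exists_schwartz_apply_zero (EuclideanSpace ℝ α)
  obtain ⟨g, hg⟩ := exists_schwartz_apply_zero (EuclideanSpace ℝ β)
  have h0 : tensor f g 0 = 1 := by
    rw [tensor_apply, (fstE (α := α) (β := β)).map_zero,
      (sndE (α := α) (β := β)).map_zero, hf, hg,
      mul_one]
  have ht := (u.continuous.tendsto F).comp (tendsto_cutoff (tensor f g) F h0)
  have hz : ∀ᶠ s : ℝ in 𝓝[>] 0, u (smulLeftCLM ℂ (fun x => tensor f g (s • x)) F) = 0 := by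
    filter_upwards [self_mem_nhdsWithin] with s hs
    have hs0 : s ≠ 0 := (show (0 : ℝ) < s from hs).ne'
    let e (ι : Type) [Fintype ι] : EuclideanSpace ℝ ι ≃L[ℝ] EuclideanSpace ℝ ι :=
      ContinuousLinearEquiv.smulLeft (Units.mk0 s hs0)
    -- A dilated tensor product is again a tensor product, so the previous lemma covers every
    -- cutoff.
    have he : (fun x => tensor f g (s • x)) =
        tensor (compCLMOfContinuousLinearEquiv ℂ (e α) f)
          (compCLMOfContinuousLinearEquiv ℂ (e β) g) := by
      ext x
      rw [tensor_apply, tensor_apply, (fstE (α := α) (β := β)).map_smul,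
        (sndE (α := α) (β := β)).map_smul]
      rfl
    rw [he]
    exact apply_tensor_mul_eq_zero u hu _ _ F
  exact tendsto_nhds_unique_of_eventuallyEq ht tendsto_const_nhds hz

end density

end

end MetaLoc

namespace MetaLoc
noncomputable section

open scoped InnerProductSpace

/-! ### Schur's lemma -/

section schur
variable {V : Type} [NormedAddCommGroup V] [InnerProductSpace ℝ V] [FiniteDimensional ℝ V]
  [MeasurableSpace V] [BorelSpace V]

/-- If the Fourier transforms of two integrable functions agree, then so do their integrals
against Schwartz functions. -/
theorem integral_schwartz_mul_eq_of_fourier_eq {F G : V → ℂ} (hF : Integrable F)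
    (hG : Integrable G)
    (h : ∀ ξ, ∫ t, (Real.fourierChar (inner ℝ ξ t) : ℂ) * F t =
      ∫ t, (Real.fourierChar (inner ℝ ξ t) : ℂ) * G t) (f : 𝓢(V, ℂ)) :
    ∫ t, f t * F t = ∫ t, f t * G t := by
  -- Write `f` as the Fourier transform of `𝓕⁻ f` and move the transform to `F`; only the Fourier
  -- integrals of `F` remain.
  have key : ∀ {F : V → ℂ}, Integrable F → ∫ t, f t * F t =
      ∫ ξ, (𝓕⁻ f : 𝓢(V, ℂ)) ξ * ∫ t, (Real.fourierChar (inner ℝ (-ξ) t) : ℂ) * F t := by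
    intro F hF
    have h1 := VectorFourier.integral_fourierIntegral_smul_eq_flip (μ := (volume : Measure V))
      (ν := (volume : Measure V)) (L := innerₗ V) Real.continuous_fourierChar continuous_inner
      (𝓕⁻ f).integrable hF
    have h2 : ∀ t, VectorFourier.fourierIntegral Real.fourierChar volume (innerₗ V)
        (𝓕⁻ f : 𝓢(V, ℂ)) t = f t := by
      intro t
      have : (𝓕 (𝓕⁻ f : 𝓢(V, ℂ)) : 𝓢(V, ℂ)) t = f t := by rw [fourier_fourierInv_eq]
      exact this
    simp only [h2, smul_eq_mul] at h1
    rw [h1]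
    refine integral_congr_ae (Filter.Eventually.of_forall fun ξ => ?_)
    simp only [VectorFourier.fourierIntegral, LinearMap.flip_apply, innerₗ_apply_apply,
      Circle.smul_def, smul_eq_mul, inner_neg_left]
  rw [key hF, key hG]
  simp only [h]

variable (T : Lp ℂ 2 (volume : Measure V) →L[ℂ] Lp ℂ 2 (volume : Measure V))

/-- With `S` the adjoint of `T`, compare the pointwise inner products `⟨S h, g⟩` and `⟨h, T g⟩`,
both in `L¹`. Commutation with modulations says that their integrals against every character agree,
and hence so do their integrals against `f`. -/
theorem inner_apply_smulLeftCLM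
    (hM : ∀ (ξ : V) (f : 𝓢(V, ℂ)), T ((modulate ξ f).toLp 2 volume) =ᵐ[volume]
      fun t => (Real.fourierChar (inner ℝ ξ t) : ℂ) * T (f.toLp 2 volume) t)
    (f g : 𝓢(V, ℂ)) (h : Lp ℂ 2 (volume : Measure V)) :
    inner ℂ h (T ((smulLeftCLM ℂ f g).toLp 2 volume)) =
      ∫ t, f t * inner ℂ (h t) (T (g.toLp 2 volume) t) := by
  have e1 : ∀ (w : V → ℂ) (u : 𝓢(V, ℂ)) (_ : ∀ t, u t = w t * g t),
      inner ℂ h (T (u.toLp 2 volume)) =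
        ∫ t, w t * inner ℂ (ContinuousLinearMap.adjoint T h t) ((g.toLp 2 volume : V → ℂ) t) := by
    intro w u hu
    rw [← ContinuousLinearMap.adjoint_inner_left, L2.inner_def]
    refine integral_congr_ae ?_
    filter_upwards [u.coeFn_toLp 2 volume, g.coeFn_toLp 2 volume] with t h1 h2
    rw [h1, h2, hu, ← smul_eq_mul (w t), inner_smul_right]
  rw [e1 f _ fun t => smulLeftCLM_apply_apply f.hasTemperateGrowth g t]
  refine integral_schwartz_mul_eq_of_fourier_eq (L2.integrable_inner _ _)
    (L2.integrable_inner _ _) (fun ξ => ?_) f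
  rw [← e1 _ _ fun t => modulate_apply ξ g t, L2.inner_def]
  refine integral_congr_ae ?_
  filter_upwards [hM ξ g] with t ht
  rw [ht, ← smul_eq_mul (Real.fourierChar _ : ℂ), inner_smul_right]

theorem apply_smulLeftCLM_ae_eq
    (hM : ∀ (ξ : V) (f : 𝓢(V, ℂ)), T ((modulate ξ f).toLp 2 volume) =ᵐ[volume]
      fun t => (Real.fourierChar (inner ℝ ξ t) : ℂ) * T (f.toLp 2 volume) t)
    (f g : 𝓢(V, ℂ)) :
    T ((smulLeftCLM ℂ f g).toLp 2 volume) =ᵐ[volume] fun t => f t * T (g.toLp 2 volume) t := by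
  have hm : MemLp (fun t => f t * T (g.toLp 2 volume) t) 2 volume :=
    MemLp.mul' (p := ⊤) (Lp.memLp _) (f.memLp_top volume)
  have h1 : T ((smulLeftCLM ℂ f g).toLp 2 volume) = hm.toLp _ := by
    refine ext_inner_left ℂ fun h => ?_
    rw [inner_apply_smulLeftCLM T hM, L2.inner_def]
    refine integral_congr_ae ?_
    filter_upwards [hm.coeFn_toLp] with t ht
    rw [ht, ← smul_eq_mul (f t) (T _ t), inner_smul_right]
  rw [h1]
  exact hm.coeFn_toLp

/-- **Schur's lemma** for the Schrödinger representation: a bounded operator which commutes with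
modulations and translations of Schwartz functions is a scalar. -/
theorem exists_eq_smul_of_commute
    (hM : ∀ (ξ : V) (f : 𝓢(V, ℂ)), T ((modulate ξ f).toLp 2 volume) =ᵐ[volume]
      fun t => (Real.fourierChar (inner ℝ ξ t) : ℂ) * T (f.toLp 2 volume) t)
    (hT : ∀ (x : V) (f : 𝓢(V, ℂ)), T ((compSubConstCLM ℂ x f).toLp 2 volume) =ᵐ[volume]
      fun t => T (f.toLp 2 volume) (t - x)) :
    ∃ c : ℂ, ∀ f : 𝓢(V, ℂ), T (f.toLp 2 volume) = c • f.toLp 2 volume := by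
  -- `T` commutes with multiplication by Schwartz functions, so both sides are `T (f g)`.
  have hcomm : ∀ f g : 𝓢(V, ℂ), ∀ᵐ t,
      f t * T (g.toLp 2 volume) t = g t * T (f.toLp 2 volume) t := by
    intro f g
    have e : smulLeftCLM ℂ f g = smulLeftCLM ℂ g f := by
      ext t
      rw [smulLeftCLM_apply_apply f.hasTemperateGrowth, smulLeftCLM_apply_apply
        g.hasTemperateGrowth, smul_eq_mul, smul_eq_mul, mul_comm]
    filter_upwards [apply_smulLeftCLM_ae_eq T hM f g, apply_smulLeftCLM_ae_eq T hM g f]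
      with t h1 h2
    rw [← h1, ← h2, e]
  have hprod : ∀ f g : 𝓢(V, ℂ), ∀ᵐ t, ∀ᵐ s,
      f t * T (g.toLp 2 volume) s = g s * T (f.toLp 2 volume) t := by
    intro f g
    -- Translating `g` by `x` decouples the two arguments. The null set depends on `x`, so joint
    -- measurability is used to exchange the quantifiers; then `s = t - x` is substituted for fixed
    -- `t`.
    have h1 : ∀ x : V, ∀ᵐ t,
        f t * T (g.toLp 2 volume) (t - x) = g (t - x) * T (f.toLp 2 volume) t := by
      intro x
      filter_upwards [hcomm f (compSubConstCLM ℂ x g), hT x g] with t h2 h3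
      rwa [h3, compSubConstCLM_apply] at h2
    have hTm : ∀ f : 𝓢(V, ℂ), Measurable (T (f.toLp 2 volume)) := fun f =>
      (Lp.stronglyMeasurable _).measurable
    have hmeas : MeasurableSet {p : V × V |
        f p.2 * T (g.toLp 2 volume) (p.2 - p.1) = g (p.2 - p.1) * T (f.toLp 2 volume) p.2} := by
      refine measurableSet_eq_fun ?_ ?_
      · exact (f.continuous.measurable.comp measurable_snd).mul
          ((hTm g).comp (measurable_snd.sub measurable_fst))
      · exact (g.continuous.measurable.comp (measurable_snd.sub measurable_fst)).mul
          ((hTm f).comp measurable_snd)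
    have h2 := (Measure.ae_ae_comm (μ := (volume : Measure V)) (ν := (volume : Measure V))
      hmeas).mp (Filter.Eventually.of_forall h1)
    filter_upwards [h2] with t ht
    have h3 := (Measure.measurePreserving_sub_left
      (volume : Measure V) t).quasiMeasurePreserving.ae ht
    simpa using h3
  obtain ⟨g, hg⟩ := exists_schwartz_apply_zero V
  have hg0 : g.toLp 2 volume ≠ 0 := by
    intro h
    have h0 : g = 0 := SchwartzMap.injective_toLp 2 volume (h.trans rfl)
    rw [h0] at hg
    exact zero_ne_one hg
  -- Integrating `f(t) (T g)(s) = g(s) (T f)(t)` against `conj (g s)` in `s` gives `⟨g, T g⟩ f = ⟨g,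
  -- g⟩ T f`.
  refine ⟨inner ℂ (g.toLp 2 volume) (T (g.toLp 2 volume)) /
    inner ℂ (g.toLp 2 volume) (g.toLp 2 volume), fun f => ?_⟩
  refine Lp.ext ?_
  filter_upwards [hprod f g, f.coeFn_toLp 2 volume,
    Lp.coeFn_smul (inner ℂ (g.toLp 2 volume) (T (g.toLp 2 volume)) /
    inner ℂ (g.toLp 2 volume) (g.toLp 2 volume)) (f.toLp 2 volume)] with t ht h1 h2
  rw [h2, Pi.smul_apply, h1, smul_eq_mul, div_mul_eq_mul_div, eq_div_iff
    (inner_self_ne_zero.mpr hg0), mul_comm, mul_comm _ (f t), L2.inner_def, L2.inner_def,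
    ← integral_const_mul, ← integral_mul_const]
  refine integral_congr_ae ?_
  filter_upwards [ht, g.coeFn_toLp 2 volume] with s hs h3
  rw [h3]
  simp only [RCLike.inner_apply]
  linear_combination -(starRingEnd ℂ (g s)) * hs

end schur

end

end MetaLoc

namespace MetaLoc
noncomputable section

/-! ### Linear changes of variables -/

section linearChange
variable {ι : Type} [Fintype ι] [DecidableEq ι]

theorem act_mul (M N : Matrix ι ι ℝ) (x : EuclideanSpace ℝ ι) :
    act (M * N) x = act M (act N x) := by
  rw [act, map_mul]
  rfl

theorem act_apply (M : Matrix ι ι ℝ) (x : EuclideanSpace ℝ ι) (i : ι) :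
    act M x i = ∑ j, M i j * x j := rfl

theorem act_one (x : EuclideanSpace ℝ ι) : act (1 : Matrix ι ι ℝ) x = x := by
  rw [act, map_one]
  rfl

theorem act_zero (x : EuclideanSpace ℝ ι) : act (0 : Matrix ι ι ℝ) x = 0 := by
  rw [act, map_zero]
  rfl

theorem act_neg (M : Matrix ι ι ℝ) (x : EuclideanSpace ℝ ι) : act (-M) x = -act M x := by
  rw [act, map_neg]
  rfl

theorem inner_act_transpose (M : Matrix ι ι ℝ) (x y : EuclideanSpace ℝ ι) :
    inner ℝ (act Mᵀ x) y = inner ℝ x (act M y) := by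
  simp only [PiLp.inner_apply, act_apply, RCLike.inner_apply, conj_trivial, Matrix.transpose_apply,
    Finset.mul_sum, Finset.sum_mul]
  rw [Finset.sum_comm]
  refine Finset.sum_congr rfl fun i _ => Finset.sum_congr rfl fun j _ => ?_
  ring

theorem act_inv_act (E : GL ι ℝ) (x : EuclideanSpace ℝ ι) :
    act ((E⁻¹ : GL ι ℝ) : Matrix ι ι ℝ) (act (E : Matrix ι ι ℝ) x) = x :=
  (actGL E).symm_apply_apply x

theorem act_act_inv (E : GL ι ℝ) (x : EuclideanSpace ℝ ι) :
    act (E : Matrix ι ι ℝ) (act ((E⁻¹ : GL ι ℝ) : Matrix ι ι ℝ) x) = x :=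
  (actGL E).apply_symm_apply x

theorem det_act (M : Matrix ι ι ℝ) :
    LinearMap.det (act M : EuclideanSpace ℝ ι →ₗ[ℝ] EuclideanSpace ℝ ι) = M.det := by
  have h : (act M : EuclideanSpace ℝ ι →ₗ[ℝ] EuclideanSpace ℝ ι) =
      Matrix.toLin (EuclideanSpace.basisFun ι ℝ).toBasis (EuclideanSpace.basisFun ι ℝ).toBasis M :=
    rfl
  rw [h, LinearMap.det_toLin]

theorem integral_comp_actGL {G : Type*} [NormedAddCommGroup G] [NormedSpace ℝ G] (E : GL ι ℝ)
    (f : EuclideanSpace ℝ ι → G) :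
    ∫ x, f (actGL E x) = |(E : Matrix ι ι ℝ).det|⁻¹ • ∫ x, f x := by
  have hd : LinearMap.det (act (E : Matrix ι ι ℝ) : EuclideanSpace ℝ ι →ₗ[ℝ] EuclideanSpace ℝ ι)
      ≠ 0 := by
    rw [det_act]
    exact ((Matrix.isUnit_iff_isUnit_det _).mp E.isUnit).ne_zero
  have h := Measure.map_linearMap_addHaar_eq_smul_addHaar
    (volume : Measure (EuclideanSpace ℝ ι)) hd
  rw [det_act, abs_inv] at h
  have he : MeasurableEmbedding (actGL E) := (actGL E).toHomeomorph.measurableEmbedding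
  have h2 := he.integral_map (μ := volume) f
  rw [← h2]
  change ∫ y, f y ∂(Measure.map (act (E : Matrix ι ι ℝ)) volume) = _
  rw [show Measure.map (act (E : Matrix ι ι ℝ)) volume = _ from h, integral_smul_measure,
    ENNReal.toReal_ofReal (by positivity)]

end linearChange

/-! ### The partial Fourier transform and Plancherel -/

section partialFourierTransform
variable {α β : Type} [Fintype α] [Fintype β]

/-- The linear map `(x, y) ↦ (x, -y)`. -/
def reflSndL : EuclideanSpace ℝ (α ⊕ β) →L[ℝ] EuclideanSpace ℝ (α ⊕ β) :=
  inlE ∘L fstE - inrE ∘L sndE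

theorem reflSndL_apply (z : EuclideanSpace ℝ (α ⊕ β)) :
    reflSndL z = pairE (fstE z) (-sndE z) := by
  rw [pairE_eq, map_neg, ← sub_eq_add_neg]; rfl

/-- The reflection `(x, y) ↦ (x, -y)`. -/
def reflSnd : EuclideanSpace ℝ (α ⊕ β) ≃L[ℝ] EuclideanSpace ℝ (α ⊕ β) :=
  ContinuousLinearEquiv.equivOfInverse reflSndL reflSndL
    (fun z => by simp [reflSndL_apply]) (fun z => by simp [reflSndL_apply])

theorem reflSnd_apply (z : EuclideanSpace ℝ (α ⊕ β)) :
    reflSnd z = pairE (fstE z) (-sndE z) := reflSndL_apply z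

/-- The Fourier transform in the second variable on Schwartz functions. -/
def partialFourierS : 𝓢(EuclideanSpace ℝ (α ⊕ β), ℂ) →L[ℂ] 𝓢(EuclideanSpace ℝ (α ⊕ β), ℂ) :=
  compCLMOfContinuousLinearEquiv ℂ reflSnd ∘L partialFourierInvS

theorem partialFourierInvS_apply (f : 𝓢(EuclideanSpace ℝ (α ⊕ β), ℂ))
    (z : EuclideanSpace ℝ (α ⊕ β)) : partialFourierInvS f z = pfiFun f z := rfl

theorem partialFourierS_apply (f : 𝓢(EuclideanSpace ℝ (α ⊕ β), ℂ))
    (z : EuclideanSpace ℝ (α ⊕ β)) :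
    partialFourierS f z = ∫ η : EuclideanSpace ℝ β,
      (Real.fourierChar (-inner ℝ η (sndE z)) : ℂ) * f (pairE (fstE z) η) := by
  change pfiFun f (reflSnd z) = _
  simp only [pfiFun, reflSnd_apply, sndE_pairE, fstE_pairE, inner_neg_right, Circle.smul_def,
    smul_eq_mul]

theorem partialFourierS_eq_fourier_slice (f : 𝓢(EuclideanSpace ℝ (α ⊕ β), ℂ))
    (z : EuclideanSpace ℝ (α ⊕ β)) :
    partialFourierS f z = (𝓕 (slice (fstE z) f) : 𝓢(EuclideanSpace ℝ β, ℂ)) (sndE z) := by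
  rw [partialFourierS_apply, SchwartzMap.fourier_coe, Real.fourier_eq]
  rfl

theorem integrable_norm_sq (f : 𝓢(EuclideanSpace ℝ (α ⊕ β), ℂ)) :
    Integrable fun z => ‖f z‖ ^ 2 :=
  (f.memLp 2 volume).integrable_norm_pow two_ne_zero

/-- Plancherel on each slice, integrated over the first variable. -/
theorem integral_norm_sq_partialFourierS (f : 𝓢(EuclideanSpace ℝ (α ⊕ β), ℂ)) :
    ∫ z, ‖partialFourierS f z‖ ^ 2 = ∫ z, ‖f z‖ ^ 2 := by
  rw [integral_eq_integral_pairE (integrable_norm_sq _),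
    integral_eq_integral_pairE (integrable_norm_sq _)]
  refine integral_congr_ae (Filter.Eventually.of_forall fun x => ?_)
  simp only [partialFourierS_eq_fourier_slice, fstE_pairE, sndE_pairE]
  exact integral_norm_sq_fourier (slice x f)

end partialFourierTransform

theorem norm_toL2_eq_of_integral {V : Type} [NormedAddCommGroup V] [InnerProductSpace ℝ V]
    [FiniteDimensional ℝ V] [MeasurableSpace V] [BorelSpace V] {f g : 𝓢(V, ℂ)}
    (h : ∫ z, ‖f z‖ ^ 2 = ∫ z, ‖g z‖ ^ 2) : ‖f.toLp 2 volume‖ = ‖g.toLp 2 volume‖ := by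
  rw [norm_toLp' two_ne_zero ENNReal.ofNat_ne_top, norm_toLp' two_ne_zero ENNReal.ofNat_ne_top]
  simp only [ENNReal.toReal_ofNat, Real.rpow_ofNat, h]

/-! ### The explicit metaplectic operator -/

section metaplecticSchwartz
variable {d : ℕ}

/-- The operator `f ↦ |det E|^{1/2} 𝓕₂(f(E ·))` on Schwartz functions, which is a metaplectic
operator over `𝒜_FT2 𝒟_E`. -/
def metaS (E : GL (Fin d ⊕ Fin d) ℝ) : 𝓢(R2d d, ℂ) →L[ℂ] 𝓢(R2d d, ℂ) :=
  ((√|(E : Matrix (Fin d ⊕ Fin d) (Fin d ⊕ Fin d) ℝ).det| : ℝ) : ℂ) •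
    (partialFourierS ∘L compCLMOfContinuousLinearEquiv ℂ (actGL E))

theorem metaS_apply (E : GL (Fin d ⊕ Fin d) ℝ) (f : 𝓢(R2d d, ℂ)) (z : R2d d) :
    metaS E f z = ((√|(E : Matrix (Fin d ⊕ Fin d) (Fin d ⊕ Fin d) ℝ).det| : ℝ) : ℂ) *
      partialFourierS (compCLMOfContinuousLinearEquiv ℂ (actGL E) f) z := rfl

theorem norm_toL2_metaS (E : GL (Fin d ⊕ Fin d) ℝ) (f : 𝓢(R2d d, ℂ)) :
    ‖(metaS E f).toLp 2 volume‖ = ‖f.toLp 2 volume‖ := by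
  refine norm_toL2_eq_of_integral ?_
  have hd : |(E : Matrix (Fin d ⊕ Fin d) (Fin d ⊕ Fin d) ℝ).det| ≠ 0 :=
    abs_ne_zero.mpr ((Matrix.isUnit_iff_isUnit_det _).mp E.isUnit).ne_zero
  simp only [metaS_apply, norm_mul, mul_pow, Complex.norm_real, Real.norm_eq_abs, sq_abs,
    Real.sq_sqrt (abs_nonneg _)]
  rw [integral_const_mul, integral_norm_sq_partialFourierS]
  have h := integral_comp_actGL E fun z => ‖f z‖ ^ 2
  change |(E : Matrix (Fin d ⊕ Fin d) (Fin d ⊕ Fin d) ℝ).det| * ∫ z, ‖f (actGL E z)‖ ^ 2 = _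
  rw [h, smul_eq_mul, mul_inv_cancel_left₀ hd]

theorem act_fromBlocks (A B C D : Matrix (Fin d) (Fin d) ℝ) (z : R2d d) :
    act (Matrix.fromBlocks A B C D) z =
      pairE (act A (fstE z) + act B (sndE z)) (act C (fstE z) + act D (sndE z)) := by
  ext i
  cases i <;> simp [act_apply, pairE]

theorem act_fromBlocks' (A B C D : Matrix (Fin d ⊕ Fin d) (Fin d ⊕ Fin d) ℝ)
    (z : EuclideanSpace ℝ ((Fin d ⊕ Fin d) ⊕ (Fin d ⊕ Fin d))) :
    act (Matrix.fromBlocks A B C D) z =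
      pairE (act A (fstE z) + act B (sndE z)) (act C (fstE z) + act D (sndE z)) := by
  ext i
  cases i <;> simp [act_apply, pairE]

theorem act_AFT2 (w : EuclideanSpace ℝ ((Fin d ⊕ Fin d) ⊕ (Fin d ⊕ Fin d))) :
    act (AFT2 d) w = pairE (pairE (fstE (fstE w)) (sndE (sndE w)))
      (pairE (fstE (sndE w)) (-sndE (fstE w))) := by
  rw [AFT2, act_fromBlocks', act_fromBlocks, act_fromBlocks, act_fromBlocks, act_fromBlocks]
  simp only [act_one, act_zero, act_neg]
  ext i
  rcases i with (i | i) | (i | i) <;> simp [pairE]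

theorem act_dilationMatrix (E : GL (Fin d ⊕ Fin d) ℝ)
    (w : EuclideanSpace ℝ ((Fin d ⊕ Fin d) ⊕ (Fin d ⊕ Fin d))) :
    act (dilationMatrix E) w =
      pairE (act ((E⁻¹ : GL (Fin d ⊕ Fin d) ℝ) : Matrix _ _ ℝ) (fstE w))
        (act (E : Matrix (Fin d ⊕ Fin d) (Fin d ⊕ Fin d) ℝ)ᵀ (sndE w)) := by
  rw [dilationMatrix, act_fromBlocks']
  simp only [act_zero, add_zero, zero_add]

/-- This is where `𝒟_E` comes from: composition with `E` turns translation by `x` into translation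
by `E⁻¹ x` and frequency `ξ` into `Eᵀ ξ`, while `ξ·x` is preserved. -/
theorem schrodingerFun_comp_actGL (E : GL (Fin d ⊕ Fin d) ℝ) (x ξ : R2d d) (τ : ℝ)
    (f : R2d d → ℂ) (t : R2d d) :
    schrodingerFun x ξ τ f (actGL E t) =
      schrodingerFun (act ((E⁻¹ : GL (Fin d ⊕ Fin d) ℝ) : Matrix _ _ ℝ) x)
        (act (E : Matrix (Fin d ⊕ Fin d) (Fin d ⊕ Fin d) ℝ)ᵀ ξ) τ (fun t => f (actGL E t)) t := by
  have h : actGL E (act ((E⁻¹ : GL (Fin d ⊕ Fin d) ℝ) : Matrix _ _ ℝ) x) = x := act_act_inv E x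
  have h' : act (E : Matrix (Fin d ⊕ Fin d) (Fin d ⊕ Fin d) ℝ)
    (act ((E⁻¹ : GL (Fin d ⊕ Fin d) ℝ) : Matrix _ _ ℝ) x) = x := act_act_inv E x
  simp only [schrodingerFun, inner_act_transpose, map_sub, h, h']
  rfl

/-- This is where `𝒜_FT2` comes from: in the second variable, `𝓕₂` exchanges translation and
modulation, up to a sign. The factor `exp(-πi ξ·x)` is the symmetric normalization for which no
extra phase appears. -/
theorem partialFourierS_schrodingerFun (a b : R2d d) (τ : ℝ) (f f' : 𝓢(R2d d, ℂ))
    (h : ∀ t, f' t = schrodingerFun a b τ f t) (z : R2d d) :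
    partialFourierS f' z = schrodingerFun (pairE (fstE a) (sndE b)) (pairE (fstE b) (-sndE a)) τ
      (partialFourierS f) z := by
  -- Shifting `η` by the second block of `a` undoes the translation in the integration variable.
  rw [partialFourierS_apply, schrodingerFun, partialFourierS_apply,
    ← integral_add_right_eq_self _ (sndE a), ← integral_const_mul, ← integral_const_mul]
  refine integral_congr_ae (Filter.Eventually.of_forall fun η => ?_)
  have e : pairE (fstE z) (η + sndE a) - a = pairE (fstE (z - pairE (fstE a) (sndE b))) η := by
    have : pairE (fstE a) (sndE a) = a := pairE_fstE_sndE a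
    conv_lhs => rw [← this]
    ext i; cases i <;> simp [pairE]
  simp only [h, schrodingerFun]
  rw [e, Real.fourierChar_apply, Real.fourierChar_apply]
  generalize f (pairE (fstE (z - pairE (fstE a) (sndE b))) η) = v
  simp only [← mul_assoc, ← Complex.exp_add]
  congr 2
  simp only [inner_eq_add, fstE_pairE, sndE_pairE, map_sub, inner_sub_right, inner_add_left,
    inner_add_right, inner_neg_left, real_inner_comm (sndE b) η, real_inner_comm (sndE a) (sndE b)]
  push_cast
  ring

theorem metaS_schrodingerFun {𝒜 : Matrix.symplecticGroup (Fin d ⊕ Fin d) ℝ}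
    {E : GL (Fin d ⊕ Fin d) ℝ} (h𝒜 : IsWignerDecomposition 𝒜 E)
    (w : EuclideanSpace ℝ ((Fin d ⊕ Fin d) ⊕ (Fin d ⊕ Fin d))) (τ : ℝ) (f f' : 𝓢(R2d d, ℂ))
    (h : ∀ t, f' t = schrodingerFun (fstE w) (sndE w) τ f t) (z : R2d d) :
    metaS E f' z = schrodingerFun (fstE (act (𝒜 : Matrix _ _ ℝ) w))
      (sndE (act (𝒜 : Matrix _ _ ℝ) w)) τ (metaS E f) z := by
  have h1 := partialFourierS_schrodingerFun _ _ τ (compCLMOfContinuousLinearEquiv ℂ (actGL E) f)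
    (compCLMOfContinuousLinearEquiv ℂ (actGL E) f')
    (fun t => (h (actGL E t)).trans (schrodingerFun_comp_actGL E _ _ τ f t)) z
  have h2 : (𝒜 : Matrix _ _ ℝ) = AFT2 d * dilationMatrix E := h𝒜
  rw [metaS_apply, h1, h2, act_mul, act_dilationMatrix, act_AFT2]
  simp only [fstE_pairE, sndE_pairE, schrodingerFun, metaS_apply]
  ring

theorem schrodinger_toLp {ι : Type} [Fintype ι] (x ξ : EuclideanSpace ℝ ι) (τ : ℝ)
    (f f' : 𝓢(EuclideanSpace ℝ ι, ℂ)) (h : ∀ t, f' t = schrodingerFun x ξ τ f t) :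
    schrodinger x ξ τ (f.toLp 2 volume) = f'.toLp 2 volume := by
  refine Lp.ext ?_
  have h1 := (memLp_schrodingerFun x ξ τ (f.toLp 2 volume)).coeFn_toLp
  have h2 := (measurePreserving_sub_right (volume : Measure (EuclideanSpace ℝ ι))
    x).quasiMeasurePreserving.ae (f.coeFn_toLp 2 volume)
  filter_upwards [h1, h2, f'.coeFn_toLp 2 volume] with t h3 h4 h5
  rw [h5, h]
  refine h3.trans ?_
  rw [schrodingerFun, schrodingerFun, h4]

variable {𝒜 : Matrix.symplecticGroup (Fin d ⊕ Fin d) ℝ} {E : GL (Fin d ⊕ Fin d) ℝ}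
  {U : L2 (Fin d ⊕ Fin d) ≃ₗᵢ[ℂ] L2 (Fin d ⊕ Fin d)}

/-- Both `metaS E` and `U` carry `ρ(w; τ)` to `ρ(𝒜 w; τ)`, so `U⁻¹ ∘ metaS E` commutes with `ρ`. -/
theorem symm_metaS_schrodinger (h𝒜 : IsWignerDecomposition 𝒜 E)
    (hU : IsMetaplectic (𝒜 : Matrix _ _ ℝ) U) (x ξ : R2d d) (τ : ℝ) (f f' : 𝓢(R2d d, ℂ))
    (h : ∀ t, f' t = schrodingerFun x ξ τ f t) :
    U.symm ((metaS E f').toLp 2 volume) =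
      schrodinger x ξ τ (U.symm ((metaS E f).toLp 2 volume)) := by
  rw [U.symm_apply_eq]
  have h1 := hU (pairE x ξ) τ (U.symm ((metaS E f).toLp 2 volume))
  rw [fstE_pairE, sndE_pairE, U.apply_symm_apply] at h1
  rw [h1]
  exact (schrodinger_toLp _ _ τ _ _ (metaS_schrodingerFun h𝒜 (pairE x ξ) τ f f' h)).symm

/-- A metaplectic operator over `𝒜_FT2 𝒟_E` agrees with `metaS E` on Schwartz functions up to a
phase factor. -/
theorem exists_phase (h𝒜 : IsWignerDecomposition 𝒜 E)
    (hU : IsMetaplectic (𝒜 : Matrix _ _ ℝ) U) : ∃ c : ℂ, ‖c‖ = 1 ∧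
      ∀ f : 𝓢(R2d d, ℂ), U (f.toLp 2 volume) = (c • metaS E f).toLp 2 volume := by
  let e : 𝓢(R2d d, ℂ) →ₗ[ℂ] L2 (Fin d ⊕ Fin d) := (toLpCLM ℂ ℂ 2 volume).toLinearMap
  let V : 𝓢(R2d d, ℂ) →ₗ[ℂ] L2 (Fin d ⊕ Fin d) := e ∘ₗ (metaS E).toLinearMap
  -- Schwartz functions are dense in `L²` and `metaS E` preserves the norm, so it extends to `L²`.
  -- Schur's lemma is applied to this extension followed by `U⁻¹`.
  let T : L2 (Fin d ⊕ Fin d) →L[ℂ] L2 (Fin d ⊕ Fin d) :=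
    (U.symm.toContinuousLinearEquiv : L2 (Fin d ⊕ Fin d) →L[ℂ] L2 (Fin d ⊕ Fin d)) ∘L
      V.extendOfNorm e
  have hT : ∀ f : 𝓢(R2d d, ℂ), T (f.toLp 2 volume) = U.symm ((metaS E f).toLp 2 volume) := by
    intro f
    have h := LinearMap.extendOfNorm_eq (f := V) (e := e)
      (SchwartzMap.denseRange_toLpCLM (μ := volume) ENNReal.ofNat_ne_top)
      ⟨1, fun f => by rw [one_mul]; exact (norm_toL2_metaS E f).le⟩ f
    exact congrArg U.symm h
  obtain ⟨c, hc⟩ := exists_eq_smul_of_commute T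
    (fun ξ f => by
      have h := symm_metaS_schrodinger h𝒜 hU 0 ξ 0 f (modulate ξ f) fun t => by
        rw [modulate_apply, schrodingerFun, Real.fourierChar_apply]
        simp
      rw [hT, hT, h]
      filter_upwards [(memLp_schrodingerFun 0 ξ 0
        (U.symm ((metaS E f).toLp 2 volume))).coeFn_toLp] with t ht
      refine ht.trans ?_
      rw [schrodingerFun, Real.fourierChar_apply]
      simp)
    (fun x f => by
      have h := symm_metaS_schrodinger h𝒜 hU x 0 0 f (compSubConstCLM ℂ x f) fun t => by
        rw [compSubConstCLM_apply, schrodingerFun]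
        simp
      rw [hT, hT, h]
      filter_upwards [(memLp_schrodingerFun x 0 0
        (U.symm ((metaS E f).toLp 2 volume))).coeFn_toLp] with t ht
      refine ht.trans ?_
      rw [schrodingerFun]
      simp)
  have hc' : ∀ f : 𝓢(R2d d, ℂ), (metaS E f).toLp 2 volume = c • U (f.toLp 2 volume) := by
    intro f
    have h := hc f
    rw [hT, U.symm_apply_eq, map_smul] at h
    exact h
  have hn : ‖c‖ = 1 := by
    obtain ⟨g, hg⟩ := exists_schwartz_apply_zero (R2d d)
    have hg0 : g.toLp 2 volume ≠ 0 := by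
      intro h
      have h0 : g = 0 := SchwartzMap.injective_toLp 2 volume (h.trans rfl)
      rw [h0] at hg
      exact zero_ne_one hg
    have h := congrArg norm (hc' g)
    rw [norm_toL2_metaS, norm_smul, U.norm_map] at h
    exact (mul_eq_right₀ (norm_ne_zero_iff.mpr hg0)).mp h.symm
  have hc0 : c ≠ 0 := norm_ne_zero_iff.mp (by rw [hn]; exact one_ne_zero)
  refine ⟨c⁻¹, by rw [norm_inv, hn, inv_one], fun f => ?_⟩
  have h : (c⁻¹ • metaS E f).toLp 2 volume = c⁻¹ • (metaS E f).toLp 2 volume := rfl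
  rw [h, hc', smul_smul, inv_mul_cancel₀ hc0, one_smul]

end metaplecticSchwartz

end

end MetaLoc

namespace MetaLoc
noncomputable section

/-! ### Kernels, operators and uniqueness -/

section functional
variable {V : Type} [NormedAddCommGroup V] [NormedSpace ℝ V]

/-- A tempered distribution as a continuous linear functional. -/
def functional (u : 𝓢'(V, ℂ)) : 𝓢(V, ℂ) →L[ℂ] ℂ where
  toFun := u
  map_add' := map_add u
  map_smul' := map_smul u
  cont := map_continuous u

theorem conjS_conjS (f : 𝓢(V, ℂ)) : conjS (conjS f) = f := by
  ext x; simp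

theorem conjS_smul (c : ℂ) (f : 𝓢(V, ℂ)) : conjS (c • f) = (starRingEnd ℂ) c • conjS f := by
  ext x; simp

variable {α β : Type} [Fintype α] [Fintype β]

theorem conjS_tensor (f : 𝓢(EuclideanSpace ℝ α, ℂ)) (g : 𝓢(EuclideanSpace ℝ β, ℂ)) :
    conjS (tensor f g) = tensor (conjS f) (conjS g) := by
  ext x; simp

/-- A tempered distribution is the kernel of a continuous operator. -/
theorem exists_operator_of_kernel (k : 𝓢'(EuclideanSpace ℝ (α ⊕ β), ℂ)) :
    ∃ T : 𝓢(EuclideanSpace ℝ β, ℂ) →L[ℂ] 𝓢'(EuclideanSpace ℝ α, ℂ),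
      ∀ f u, T f u = k (tensor u f) := by
  have e : ∀ (f : 𝓢(EuclideanSpace ℝ β, ℂ)) (u : 𝓢(EuclideanSpace ℝ α, ℂ)),
      compCLMOfContinuousLinearEquiv ℂ (swapE (α := α) (β := β)) (tensorCLM f u) =
        tensorCLM u f := by
    intro f u
    ext z
    change f (fstE (swapE z)) * u (sndE (swapE z)) = u (fstE z) * f (sndE z)
    rw [swapE_apply, fstE_pairE, sndE_pairE, mul_comm]
  -- `tensorCLM` is bundled as continuous only in its second argument; the swap of blocks puts `u`
  -- there. Continuity in `f` for the pointwise topology uses the unswapped form `hS`.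
  let S : 𝓢(EuclideanSpace ℝ β, ℂ) → 𝓢'(EuclideanSpace ℝ α, ℂ) := fun f =>
    PointwiseConvergenceCLM.precomp ℂ
      (compCLMOfContinuousLinearEquiv ℂ (swapE (α := α) (β := β)) ∘L tensorCLM f) k
  have hS : ∀ f u, S f u = k (tensorCLM u f) := fun f u => congrArg k (e f u)
  refine ⟨⟨⟨⟨S, fun f g => ?_⟩, fun c f => ?_⟩, ?_⟩, hS⟩
  · ext u
    have h : (S f + S g) u = S f u + S g u := rfl
    rw [h, hS, hS, hS, map_add, map_add]
  · ext u
    have h : ((RingHom.id ℂ) c • S f) u = c • S f u := rfl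
    rw [h, hS, hS, map_smul, map_smul]
  · refine PointwiseConvergenceCLM.continuous_of_continuous_eval fun u => ?_
    change Continuous fun f => S f u
    simp only [hS]
    exact (map_continuous k).comp (tensorCLM u).continuous

theorem eq_of_apply_tensor_eq {k k' : 𝓢'(EuclideanSpace ℝ (α ⊕ β), ℂ)}
    (h : ∀ f g, k' (tensor f g) = k (tensor f g)) : k' = k := by
  have h0 := eq_zero_of_apply_tensor_eq_zero (functional k' - functional k) fun f g => by
    change k' _ - k _ = 0
    rw [h, sub_self]
  ext F
  exact sub_eq_zero.mp (DFunLike.congr_fun h0 F)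

end functional

/-! ### The convolution identity -/

section shear
variable {α β : Type} [Fintype α] [Fintype β]

/-- The linear map `(t, (x, y)) ↦ ((t, y), (x + t, y))`. -/
def shearL : EuclideanSpace ℝ (α ⊕ (α ⊕ β)) →L[ℝ] EuclideanSpace ℝ ((α ⊕ β) ⊕ (α ⊕ β)) :=
  inlE ∘L (inlE ∘L fstE + inrE ∘L sndE ∘L sndE) +
    inrE ∘L (inlE ∘L (fstE ∘L sndE + fstE) + inrE ∘L sndE ∘L sndE)

theorem shearL_apply (w : EuclideanSpace ℝ (α ⊕ (α ⊕ β))) :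
    shearL w = pairE (pairE (fstE w) (sndE (sndE w)))
      (pairE (fstE (sndE w) + fstE w) (sndE (sndE w))) := by
  rw [pairE_eq, pairE_eq, pairE_eq]
  rfl

/-- The map repeats `y`, so it is injective but not invertible; this lower bound is what keeps the
composite Schwartz. The `4` counts `t` twice, `x + t` and `y` once each. -/
theorem norm_le_shearL (w : EuclideanSpace ℝ (α ⊕ (α ⊕ β))) : ‖w‖ ≤ 4 * ‖shearL w‖ := by
  have h1 := norm_le_add w
  have h2 := norm_le_add (sndE w)
  have hl := norm_fstE_le (shearL w)
  have hr := norm_sndE_le (shearL w)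
  rw [shearL_apply] at hl hr ⊢
  rw [fstE_pairE] at hl
  rw [sndE_pairE] at hr
  have a1 := norm_fstE_le (pairE (fstE w) (sndE (sndE w)))
  have a2 := norm_sndE_le (pairE (fstE w) (sndE (sndE w)))
  have a3 := norm_fstE_le (pairE (fstE (sndE w) + fstE w) (sndE (sndE w)))
  rw [fstE_pairE] at a1 a3
  rw [sndE_pairE] at a2
  have a4 : ‖fstE (sndE w)‖ ≤ ‖fstE (sndE w) + fstE w‖ + ‖fstE w‖ := by
    simpa using norm_sub_le (fstE (sndE w) + fstE w) (fstE w)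
  linarith

/-- The Schwartz function `(t, (x, y)) ↦ f(t, y) g(x + t, y)`. -/
def shearTensor (f g : 𝓢(EuclideanSpace ℝ (α ⊕ β), ℂ)) :
    𝓢(EuclideanSpace ℝ (α ⊕ (α ⊕ β)), ℂ) :=
  SchwartzMap.compCLM ℂ (g := fun w => shearL w) (by fun_prop)
    ⟨1, 4, fun w => (norm_le_shearL w).trans (by rw [pow_one]; linarith)⟩ (tensor f g)

theorem shearTensor_apply (f g : 𝓢(EuclideanSpace ℝ (α ⊕ β), ℂ)) (t : EuclideanSpace ℝ α)
    (z : EuclideanSpace ℝ (α ⊕ β)) :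
    shearTensor f g (pairE t z) = f (pairE t (sndE z)) * g (pairE (fstE z + t) (sndE z)) := by
  change tensor f g (shearL (pairE t z)) = _
  rw [shearL_apply, tensor_apply]
  simp only [fstE_pairE, sndE_pairE]

/-- A translate of `𝓕⁻ q` is `𝓕⁻` of a modulation of `q`; then the Fourier transform moves from `p`
to the other factor and cancels `𝓕⁻`. -/
theorem integral_fourier_mul_fourierInv_add {V : Type} [NormedAddCommGroup V]
    [InnerProductSpace ℝ V] [FiniteDimensional ℝ V] [MeasurableSpace V] [BorelSpace V]
    (p q : 𝓢(V, ℂ)) (y : V) :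
    ∫ v, (𝓕 p : 𝓢(V, ℂ)) v * (𝓕⁻ q : 𝓢(V, ℂ)) (y + v) =
      ∫ η, p η * (Real.fourierChar (inner ℝ y η) * q η) := by
  have h : ∀ v, (𝓕⁻ q : 𝓢(V, ℂ)) (y + v) = (𝓕⁻ (modulate y q) : 𝓢(V, ℂ)) v := by
    intro v
    rw [SchwartzMap.fourierInv_coe, SchwartzMap.fourierInv_coe, Real.fourierInv_eq,
      Real.fourierInv_eq]
    refine integral_congr_ae (Filter.Eventually.of_forall fun η => ?_)
    simp only [modulate_apply, inner_add_right, AddChar.map_add_eq_mul, Circle.smul_def,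
      Circle.coe_mul, smul_eq_mul, real_inner_comm η y]
    ring
  simp only [h]
  rw [integral_fourier_mul_eq, fourier_fourierInv_eq]
  simp only [modulate_apply]

/-- The convolution of the reflected partial Fourier transform of `f` with the partial inverse
Fourier transform of `g` is the partial inverse Fourier transform of
`(x, y) ↦ ∫ f(t, y) g(x + t, y) dt`. -/
theorem convolution_partialFourierS (f g : 𝓢(EuclideanSpace ℝ (α ⊕ β), ℂ)) :
    SchwartzMap.convolution (ContinuousLinearMap.mul ℂ ℂ)
      (compCLMOfContinuousLinearEquiv ℂ
        (ContinuousLinearEquiv.neg ℝ (M := EuclideanSpace ℝ (α ⊕ β))) (partialFourierS f))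
      (partialFourierInvS g) = partialFourierInvS (marginal (shearTensor f g)) := by
  ext u
  -- The value of `𝓕₂⁻¹` at `u` is a tempered distribution, so it can be taken inside the
  -- `t`-integral. The identity then reduces to a one-block statement for each `t`.
  have hR := integral_apply_slice
    (functional (TemperedDistribution.delta u) ∘L partialFourierInvS) (shearTensor f g)
  change _ = partialFourierInvS (marginal (shearTensor f g)) u at hR
  rw [← hR, SchwartzMap.convolution_apply]
  have hL : ∫ s, partialFourierS f (-s) * partialFourierInvS g (u - s) =
      ∫ s, partialFourierS f s * partialFourierInvS g (u + s) := by
    rw [← integral_neg_eq_self]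
    simp only [neg_neg, sub_neg_eq_add]
  have hi : Integrable fun s => partialFourierS f s * partialFourierInvS g (u + s) := by
    refine (smulLeftCLM ℂ (partialFourierS f)
      (compSubConstCLM ℂ (-u) (partialFourierInvS g))).integrable.congr
      (Filter.Eventually.of_forall fun s => ?_)
    simp only [smulLeftCLM_apply_apply (partialFourierS f).hasTemperateGrowth, smul_eq_mul,
      compSubConstCLM_apply, sub_neg_eq_add, add_comm s u]
  refine hL.trans ?_
  rw [integral_eq_integral_pairE hi]
  refine integral_congr_ae (Filter.Eventually.of_forall fun t => ?_)
  change ∫ v, partialFourierS f (pairE t v) * partialFourierInvS g (u + pairE t v) =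
    partialFourierInvS (slice t (shearTensor f g)) u
  have e : ∀ v, u + pairE t v = pairE (fstE u + t) (sndE u + v) := by
    intro v
    ext i; cases i <;> simp [pairE]
  simp only [partialFourierS_eq_fourier_slice, partialFourierInvS_apply, pfiFun_eq, e, fstE_pairE,
    sndE_pairE]
  rw [integral_fourier_mul_fourierInv_add, SchwartzMap.fourierInv_coe, Real.fourierInv_eq]
  refine integral_congr_ae (Filter.Eventually.of_forall fun η => ?_)
  simp only [slice_apply, shearTensor_apply, sndE_pairE, fstE_pairE, Circle.smul_def, smul_eq_mul,
    real_inner_comm η (sndE u)]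
  ring

end shear

/-! ### The Schwartz kernel of the localization operator -/

section kernel
variable {d : ℕ}

/-- The operator `f ↦ |det E|^{1/2} 𝓕₂⁻¹(f(E ·))`, the complex conjugate of `metaS E`. -/
def metaConjS (E : GL (Fin d ⊕ Fin d) ℝ) : 𝓢(R2d d, ℂ) →L[ℂ] 𝓢(R2d d, ℂ) :=
  ((√|(E : Matrix (Fin d ⊕ Fin d) (Fin d ⊕ Fin d) ℝ).det| : ℝ) : ℂ) •
    (partialFourierInvS ∘L compCLMOfContinuousLinearEquiv ℂ (actGL E))

theorem conjS_metaS (E : GL (Fin d ⊕ Fin d) ℝ) (f : 𝓢(R2d d, ℂ)) :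
    conjS (metaS E f) = metaConjS E (conjS f) := by
  ext z
  change (starRingEnd ℂ) (_ * partialFourierS _ z) = _ * pfiFun _ z
  rw [map_mul, Complex.conj_ofReal, partialFourierS_apply, ← integral_conj, pfiFun]
  congr 1
  refine integral_congr_ae (Filter.Eventually.of_forall fun η => ?_)
  simp only [map_mul, Circle.smul_def, smul_eq_mul]
  rw [AddChar.map_neg_eq_inv, Circle.coe_inv_eq_conj, Complex.conj_conj]
  rfl

variable {𝒜 : Matrix.symplecticGroup (Fin d ⊕ Fin d) ℝ} {E : GL (Fin d ⊕ Fin d) ℝ}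
  {U : L2 (Fin d ⊕ Fin d) ≃ₗᵢ[ℂ] L2 (Fin d ⊕ Fin d)} {c : ℂ}

theorem isMetaWigner_of_phase
    (hc : ∀ f : 𝓢(R2d d, ℂ), U (f.toLp 2 volume) = (c • metaS E f).toLp 2 volume)
    (f g : 𝓢(Rd d, ℂ)) : IsMetaWigner U f g (c • metaS E (tensor f (conjS g))) :=
  (hc _).symm

theorem isMetaWigner_metaWigner
    (hc : ∀ f : 𝓢(R2d d, ℂ), U (f.toLp 2 volume) = (c • metaS E f).toLp 2 volume)
    (f g : 𝓢(Rd d, ℂ)) : IsMetaWigner U f g (metaWigner U f g) := by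
  have h : ∃ W, IsMetaWigner U f g W := ⟨_, isMetaWigner_of_phase hc f g⟩
  rw [metaWigner, dif_pos h]
  exact h.choose_spec

theorem metaWigner_eq
    (hc : ∀ f : 𝓢(R2d d, ℂ), U (f.toLp 2 volume) = (c • metaS E f).toLp 2 volume)
    (f g : 𝓢(Rd d, ℂ)) : metaWigner U f g = c • metaS E (tensor f (conjS g)) :=
  SchwartzMap.injective_toLp 2 volume
    ((isMetaWigner_metaWigner hc f g).trans (isMetaWigner_of_phase hc f g).symm)

/-- The Schwartz kernel of the metaplectic pseudodifferential operator with symbol `σ`. -/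
def metaKernel (E : GL (Fin d ⊕ Fin d) ℝ) (c : ℂ) (σ : 𝓢'(R2d d, ℂ)) : 𝓢'(R2d d, ℂ) :=
  (starRingEnd ℂ) c • PointwiseConvergenceCLM.precomp ℂ (metaConjS E) σ

theorem metaKernel_apply (E : GL (Fin d ⊕ Fin d) ℝ) (c : ℂ) (σ : 𝓢'(R2d d, ℂ))
    (f : 𝓢(R2d d, ℂ)) : metaKernel E c σ f = (starRingEnd ℂ) c * σ (metaConjS E f) := rfl

theorem bracket_metaWigner
    (hc : ∀ f : 𝓢(R2d d, ℂ), U (f.toLp 2 volume) = (c • metaS E f).toLp 2 volume)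
    (σ : 𝓢'(R2d d, ℂ)) (f g : 𝓢(Rd d, ℂ)) :
    bracket σ (metaWigner U g f) = bracket (metaKernel E c σ) (tensor g (conjS f)) := by
  rw [bracket, bracket, metaWigner_eq hc, conjS_smul, conjS_metaS, metaKernel_apply, map_smul,
    smul_eq_mul]

theorem isMetaOp_metaOp
    (hc : ∀ f : 𝓢(R2d d, ℂ), U (f.toLp 2 volume) = (c • metaS E f).toLp 2 volume)
    (σ : 𝓢'(R2d d, ℂ)) : IsMetaOp U σ (metaOp U σ) := by
  have h : ∃ T, IsMetaOp U σ T := by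
    obtain ⟨T, hT⟩ := exists_operator_of_kernel (metaKernel E c σ)
    refine ⟨T, fun f g => ?_⟩
    rw [bracket_metaWigner hc, bracket, bracket, hT, conjS_tensor, conjS_conjS]
  rw [metaOp, dif_pos h]
  exact h.choose_spec

theorem isSchwartzKernel_iff
    (hc : ∀ f : 𝓢(R2d d, ℂ), U (f.toLp 2 volume) = (c • metaS E f).toLp 2 volume)
    {σ : 𝓢'(R2d d, ℂ)} {T : 𝓢(Rd d, ℂ) →L[ℂ] 𝓢'(Rd d, ℂ)} (hT : IsMetaOp U σ T)
    (k : 𝓢'(R2d d, ℂ)) : IsSchwartzKernel T k ↔ k = metaKernel E c σ := by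
  constructor
  · intro hk
    refine eq_of_apply_tensor_eq fun f g => ?_
    -- Testing with `conjS f` makes the conjugations cancel, so that arbitrary tensors `f ⊗ g` are
    -- reached.
    have h := (hk g (conjS f)).symm.trans ((hT g (conjS f)).trans (bracket_metaWigner hc σ _ _))
    simpa only [bracket, conjS_tensor, conjS_conjS] using h
  · rintro rfl f g
    rw [hT, bracket_metaWigner hc]

/-- `C' x + D' y` is the second block of `E⁻¹ (x, y)`. In the coordinates `z = E⁻¹ (x, y)` the
window therefore depends only on `t` and the second block of `z`. -/
theorem windowFactor_apply (E : GL (Fin d ⊕ Fin d) ℝ)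
    {A B C D A' B' C' D' : Matrix (Fin d) (Fin d) ℝ}
    (hE : (E : Matrix (Fin d ⊕ Fin d) (Fin d ⊕ Fin d) ℝ) = Matrix.fromBlocks A B C D)
    (hE' : ((E⁻¹ : GL (Fin d ⊕ Fin d) ℝ) : Matrix (Fin d ⊕ Fin d) (Fin d ⊕ Fin d) ℝ) =
      Matrix.fromBlocks A' B' C' D')
    (φ₁ φ₂ : 𝓢(Rd d, ℂ)) (t : Rd d) (z : R2d d) :
    windowFactor A B C D C' D' φ₁ φ₂ t (actGL E z) =
      tensor φ₂ (conjS φ₁) (actGL E (pairE t (sndE z))) := by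
  have h1 : act C' (fstE (actGL E z)) + act D' (sndE (actGL E z)) = sndE z := by
    have h := congrArg sndE (act_fromBlocks A' B' C' D' (actGL E z))
    rw [← hE', sndE_pairE] at h
    rw [← h]
    exact congrArg sndE (act_inv_act E z)
  have h2 : actGL E (pairE t (sndE z)) =
      pairE (act A t + act B (sndE z)) (act C t + act D (sndE z)) := by
    change act (E : Matrix (Fin d ⊕ Fin d) (Fin d ⊕ Fin d) ℝ) _ = _
    rw [hE, act_fromBlocks, fstE_pairE, sndE_pairE]
  rw [windowFactor, h1, h2, tensor_apply, fstE_pairE, sndE_pairE, conjS_apply]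

/-- Each operation on `a` is transposed onto `h`: multiplication by the window, composition with
`E`, translation by `-(t, 0)`, and `𝓕₂⁻¹`. The translation leaves the window unchanged, since it
moves only the first block. -/
theorem kernelIntegrand_apply (E : GL (Fin d ⊕ Fin d) ℝ)
    {A B C D A' B' C' D' : Matrix (Fin d) (Fin d) ℝ}
    (hE : (E : Matrix (Fin d ⊕ Fin d) (Fin d ⊕ Fin d) ℝ) = Matrix.fromBlocks A B C D)
    (hE' : ((E⁻¹ : GL (Fin d ⊕ Fin d) ℝ) : Matrix (Fin d ⊕ Fin d) (Fin d ⊕ Fin d) ℝ) =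
      Matrix.fromBlocks A' B' C' D')
    (a : 𝓢'(R2d d, ℂ)) (φ₁ φ₂ : 𝓢(Rd d, ℂ)) (t : Rd d) (h : 𝓢(R2d d, ℂ)) :
    kernelIntegrand E A B C D C' D' a φ₁ φ₂ t h =
      ((|(E : Matrix (Fin d ⊕ Fin d) (Fin d ⊕ Fin d) ℝ).det| : ℝ) : ℂ) *
        a (partialFourierInvS (slice t (shearTensor
          (compCLMOfContinuousLinearEquiv ℂ (actGL E) (tensor φ₂ (conjS φ₁)))
          (compCLMOfContinuousLinearEquiv ℂ (actGL E) h)))) := by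
  have hd : (|((E⁻¹ : GL (Fin d ⊕ Fin d) ℝ) : Matrix (Fin d ⊕ Fin d) (Fin d ⊕ Fin d) ℝ).det|)⁻¹ =
      |(E : Matrix (Fin d ⊕ Fin d) (Fin d ⊕ Fin d) ℝ).det| := by
    rw [Matrix.coe_units_inv, Matrix.det_nonsing_inv, Ring.inverse_eq_inv', abs_inv, inv_inv]
  change (((|((E⁻¹ : GL (Fin d ⊕ Fin d) ℝ) :
      Matrix (Fin d ⊕ Fin d) (Fin d ⊕ Fin d) ℝ).det|)⁻¹ : ℝ) : ℂ) *
    a (partialFourierInvS (compSubConstCLM ℂ (-(pairE t 0)) (compCLMOfContinuousLinearEquiv ℂ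
      (actGL E⁻¹).symm (smulLeftCLM ℂ (windowFactor A B C D C' D' φ₁ φ₂ t) h)))) = _
  rw [hd]
  congr 3
  ext z
  have hs : ∀ v, (actGL E⁻¹).symm v = actGL E v := by
    intro v
    change act (((E⁻¹)⁻¹ : GL (Fin d ⊕ Fin d) ℝ) : Matrix _ _ ℝ) v = _
    rw [inv_inv]
    rfl
  have hz : z + pairE t 0 = pairE (fstE z + t) (sndE z) := by
    ext i; cases i <;> simp [pairE]
  rw [slice_apply, shearTensor_apply, compSubConstCLM_apply, sub_neg_eq_add, hz]
  change smulLeftCLM ℂ (windowFactor A B C D C' D' φ₁ φ₂ t) h ((actGL E⁻¹).symm _) = _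
  rw [hs, smulLeftCLM_apply_apply (windowFactor_hasTemperateGrowth A B C D C' D' φ₁ φ₂ t),
    windowFactor_apply E hE hE', sndE_pairE]
  rfl

/-- The undetermined phase cancels: `c` enters through the window in the symbol and `conj c` through
the kernel. The two square roots of `|det E|` combine to the Jacobian factor of the integrand. -/
theorem metaKernel_locSymbol_apply (hc1 : ‖c‖ = 1)
    (hc : ∀ f : 𝓢(R2d d, ℂ), U (f.toLp 2 volume) = (c • metaS E f).toLp 2 volume)
    (a : 𝓢'(R2d d, ℂ)) (φ₁ φ₂ : 𝓢(Rd d, ℂ)) (h : 𝓢(R2d d, ℂ)) :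
    metaKernel E c (locSymbol U a φ₁ φ₂) h =
      ((|(E : Matrix (Fin d ⊕ Fin d) (Fin d ⊕ Fin d) ℝ).det| : ℝ) : ℂ) *
        a (partialFourierInvS (marginal (shearTensor
          (compCLMOfContinuousLinearEquiv ℂ (actGL E) (tensor φ₂ (conjS φ₁)))
          (compCLMOfContinuousLinearEquiv ℂ (actGL E) h)))) := by
  have hcc : (starRingEnd ℂ) c * c = 1 := by
    rw [Complex.conj_mul', hc1, Complex.ofReal_one, one_pow]
  have hr : ((√|(E : Matrix (Fin d ⊕ Fin d) (Fin d ⊕ Fin d) ℝ).det| : ℝ) : ℂ) *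
      ((√|(E : Matrix (Fin d ⊕ Fin d) (Fin d ⊕ Fin d) ℝ).det| : ℝ) : ℂ) =
      ((|(E : Matrix (Fin d ⊕ Fin d) (Fin d ⊕ Fin d) ℝ).det| : ℝ) : ℂ) := by
    rw [← Complex.ofReal_mul, Real.mul_self_sqrt (abs_nonneg _)]
  set r : ℂ := ((√|(E : Matrix (Fin d ⊕ Fin d) (Fin d ⊕ Fin d) ℝ).det| : ℝ) : ℂ)
  set Φ := compCLMOfContinuousLinearEquiv ℂ (actGL E) (tensor φ₂ (conjS φ₁))
  set β := compCLMOfContinuousLinearEquiv ℂ (actGL E) h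
  have h1 : metaConjS E h = r • partialFourierInvS β := rfl
  have h2 : metaWigner U φ₂ φ₁ = c • r • partialFourierS Φ := metaWigner_eq hc φ₂ φ₁
  rw [metaKernel_apply, locSymbol, h1, h2]
  change (starRingEnd ℂ) c * a (SchwartzMap.convolution (ContinuousLinearMap.mul ℂ ℂ)
    (compCLMOfContinuousLinearEquiv ℂ (ContinuousLinearEquiv.neg ℝ (M := R2d d))
      (c • r • partialFourierS Φ)) (r • partialFourierInvS β)) = _
  have h3 : SchwartzMap.convolution (ContinuousLinearMap.mul ℂ ℂ)
      (compCLMOfContinuousLinearEquiv ℂ (ContinuousLinearEquiv.neg ℝ (M := R2d d))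
        (c • r • partialFourierS Φ)) (r • partialFourierInvS β) =
      r • c • r • partialFourierInvS (marginal (shearTensor Φ β)) := by
    rw [← convolution_partialFourierS]
    simp only [map_smul, smul_apply]
  rw [h3, map_smul, map_smul, map_smul, ← hr]
  simp only [smul_eq_mul]
  linear_combination (r * r * a (partialFourierInvS (marginal (shearTensor Φ β)))) * hcc

theorem isWeakIntegral_metaKernel (hc1 : ‖c‖ = 1)
    (hc : ∀ f : 𝓢(R2d d, ℂ), U (f.toLp 2 volume) = (c • metaS E f).toLp 2 volume)
    {A B C D A' B' C' D' : Matrix (Fin d) (Fin d) ℝ}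
    (hE : (E : Matrix (Fin d ⊕ Fin d) (Fin d ⊕ Fin d) ℝ) = Matrix.fromBlocks A B C D)
    (hE' : ((E⁻¹ : GL (Fin d ⊕ Fin d) ℝ) : Matrix (Fin d ⊕ Fin d) (Fin d ⊕ Fin d) ℝ) =
      Matrix.fromBlocks A' B' C' D')
    (a : 𝓢'(R2d d, ℂ)) (φ₁ φ₂ : 𝓢(Rd d, ℂ)) :
    IsWeakIntegral (kernelIntegrand E A B C D C' D' a φ₁ φ₂)
      (metaKernel E c (locSymbol U a φ₁ φ₂)) := by
  intro h
  simp only [bracket, kernelIntegrand_apply E hE hE', metaKernel_locSymbol_apply hc1 hc]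
  refine ⟨(integrable_apply_slice (functional a ∘L partialFourierInvS) _).const_mul _, ?_⟩
  rw [integral_const_mul]
  congr 1
  exact (integral_apply_slice (functional a ∘L partialFourierInvS) _).symm

end kernel

end

end MetaLoc

theorem proposition3 (d : ℕ)
    (𝒜 : Matrix.symplecticGroup (Fin d ⊕ Fin d) ℝ)
    (E : Matrix.GeneralLinearGroup (Fin d ⊕ Fin d) ℝ)
    (h𝒜 : IsWignerDecomposition 𝒜 E)
    (A B C D A' B' C' D' : Matrix (Fin d) (Fin d) ℝ)
    (hE : (E : Matrix (Fin d ⊕ Fin d) (Fin d ⊕ Fin d) ℝ) = Matrix.fromBlocks A B C D)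
    (hE' : ((E⁻¹ : Matrix.GeneralLinearGroup (Fin d ⊕ Fin d) ℝ) :
      Matrix (Fin d ⊕ Fin d) (Fin d ⊕ Fin d) ℝ) = Matrix.fromBlocks A' B' C' D')
    (U : L2 (Fin d ⊕ Fin d) ≃ₗᵢ[ℂ] L2 (Fin d ⊕ Fin d))
    (hU : IsMetaplectic (𝒜 : Matrix _ _ ℝ) U)
    (a : 𝓢'(R2d d, ℂ)) (φ₁ φ₂ : 𝓢(Rd d, ℂ)) :
    (∀ f g : 𝓢(Rd d, ℂ), IsMetaWigner U f g (metaWigner U f g)) ∧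
    IsMetaOp U (locSymbol U a φ₁ φ₂) (locOp U a φ₁ φ₂) ∧
    ∃ k : 𝓢'(R2d d, ℂ),
      (∀ k' : 𝓢'(R2d d, ℂ), IsSchwartzKernel (locOp U a φ₁ φ₂) k' ↔ k' = k) ∧
      IsWeakIntegral (kernelIntegrand E A B C D C' D' a φ₁ φ₂) k := by
  obtain ⟨c, hc1, hc⟩ := exists_phase h𝒜 hU
  have hop : IsMetaOp U (locSymbol U a φ₁ φ₂) (locOp U a φ₁ φ₂) := isMetaOp_metaOp hc _
  exact ⟨isMetaWigner_metaWigner hc, hop, metaKernel E c (locSymbol U a φ₁ φ₂),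
    isSchwartzKernel_iff hc hop, isWeakIntegral_metaKernel hc1 hc hE hE' a φ₁ φ₂⟩
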